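/- Let $(X_i)$ and $(Y_j)$ be two (finite or infinite) sequences of random variables with values in $[0,1]$ such that $$\sum_i X_i+\sum_j Y_j=1\ \text{ a.s.},\qquad \mathbb E\Big[\sum_i X_i\Big]<1,\qquad \mathbb E\big[\#\{i: X_i>0\}\big]>1 .$$ Start with one crumb of size $1$. Recursively, each crumb of size $\xi$ splits into crumbs of sizes $\xi X'_i$ and solids of sizes $\xi Y'_j$, where $(X',Y')$ is a copy of $(X,Y)$ and the copies used for different crumbs are independent. Solids are not split further. Let $P=(P_c)$ be the family of the sizes of all solids ever produced (a.s. $\sum_c P_c=1$). Conditionally given $P$, balls $1,2,\dots$ are painted independently, each with colour $c$ with probability $P_c$. Let $K_n$ be the number of different colours of the first $n$ balls, and $K_{nr}$ the number of colours represented exactly $r$ times among them. Put $\psi(s)=\mathbb E\big[\sum_{i:X_i>0}X_i^{s}\big]$ and $\varphi(s)=\mathbb E\big[\sum_{j:Y_j>0}Y_j^{s}\big]$ for complex $s$ for which the expectations converge absolutely. Suppose (Malthusian hypothesis) that $\alpha_*\in\mathbb R$ and $\varepsilon>0$ are such that $\psi$ converges absolutely in the half-plane $\{\operatorname{Re}s>\alpha_*-\varepsilon\}$,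 $\alpha_*$ is the unique solution of $\psi(s)=1$ in this half-plane, and $\varphi(\alpha_*-\varepsilon)<\infty$. Then $0<\alpha_*<1$, $\psi$ is differentiable at $\alpha_*$ with $\psi'(\alpha_*)\neq0$, and, as $n\to\infty$, $$\mathbb E[K_n]=n^{\alpha_*}\,\frac{\Gamma(-\alpha_*)\,\varphi(\alpha_*)}{\psi'(\alpha_*)}+O\big(n^{\alpha_*-\delta}\big)\qquad\text{for every }\delta\in(0,\varepsilon)\text{ with }\delta\le\alpha_*,$$ and, for every fixed integer $r\ge1$, $$\mathbb E[K_{nr}]=n^{\alpha_*}\,\frac{\Gamma(r-\alpha_*)\,\varphi(\alpha_*)}{-\,r!\,\psi'(\alpha_*)}+O\big(n^{\alpha_*-\delta}\big)\qquad\text{for every }\delta\in(0,\varepsilon)\text{ with }\delta\le1 .$$ -/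

import Mathlib

open MeasureTheory ProbabilityTheory Filter Asymptotics
open scoped ENNReal

namespace RecursivePartition

/-- The standing assumptions on the random splitting `(X, Y)` of the unit: `X i` are the relative
sizes of crumbs, `Y j` those of solids. A size `0` means that there is no piece with this label, so
finite sequences and sequences labelled by (possibly random) subsets of `ℕ` are covered. -/
structure IsSplitting {Ω₀ : Type*} [MeasurableSpace Ω₀] (P₀ : Measure Ω₀)
    (X Y : ℕ → Ω₀ → ℝ) : Prop where
  measurable_X : ∀ i, Measurable (X i)
  measurable_Y : ∀ j, Measurable (Y j)
  mem_Icc_X : ∀ᵐ ω ∂P₀, ∀ i, X i ω ∈ Set.Icc (0 : ℝ) 1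
  mem_Icc_Y : ∀ᵐ ω ∂P₀, ∀ j, Y j ω ∈ Set.Icc (0 : ℝ) 1
  sum_eq_one : ∀ᵐ ω ∂P₀,
    ∑' i, ENNReal.ofReal (X i ω) + ∑' j, ENNReal.ofReal (Y j ω) = 1
  mean_crumbs_lt_one : ∫⁻ ω, ∑' i, ENNReal.ofReal (X i ω) ∂P₀ < 1
  supercritical : 1 < ∫⁻ ω, (({i | 0 < X i ω} : Set ℕ).encard : ℝ≥0∞) ∂P₀

/-- The intensity measure of the point process of the positive terms among `Z 0, Z 1, …`: for
measurable `f ≥ 0`, its integral of `f` is the mean of the sum of `f (Z i)` over `i` with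
`Z i > 0`. -/
noncomputable def intensity {Ω₀ : Type*} [MeasurableSpace Ω₀] (P₀ : Measure Ω₀)
    (Z : ℕ → Ω₀ → ℝ) : Measure ℝ :=
  (Measure.sum fun i => P₀.map (Z i)).restrict (Set.Ioi 0)

/-- The Mellin transform `s ↦ ∫ x ^ s m(dx)` of a measure, as a function of a complex variable. -/
noncomputable def mellinTransform (m : Measure ℝ) (s : ℂ) : ℂ :=
  ∫ x : ℝ, (x : ℂ) ^ s ∂m

/-- The Malthusian hypothesis with exponent `α` and width `ε`, for the intensity measures `σ` of
crumbs and `ν` of solids, whose Mellin transforms are `ψ` and `φ`. The transform `ψ` converges in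
the open half-plane `Re s > α - ε`, where `α` is the only solution of `ψ s = 1`, and
`φ (α - ε) < ∞`. -/
structure Malthusian (σ ν : Measure ℝ) (α ε : ℝ) : Prop where
  eps_pos : 0 < ε
  psi_finite : ∀ a : ℝ, α - ε < a → Integrable (fun x : ℝ => x ^ a) σ
  psi_eq_one : mellinTransform σ (α : ℂ) = 1
  unique : ∀ s : ℂ, α - ε < s.re → mellinTransform σ s = 1 → s = (α : ℂ)
  phi_finite : Integrable (fun x : ℝ => x ^ (α - ε)) ν

/-- A realization of the relative splittings of all crumbs. Crumbs are labelled by words, with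
the most recent letter first: `i :: u` is the child number `i` of `u`. The pair `S u ω` gives the
relative sizes of the crumbs and of the solids into which the crumb `u` splits; these pairs are
independent copies of `(X, Y)`. -/
structure IsDivision {Ω₀ Ω : Type*} [MeasurableSpace Ω₀] [MeasurableSpace Ω] (P₀ : Measure Ω₀)
    (X Y : ℕ → Ω₀ → ℝ) (μ : Measure Ω) (S : List ℕ → Ω → (ℕ → ℝ) × (ℕ → ℝ)) : Prop where
  measurable : ∀ u, Measurable (S u)
  indep : iIndepFun S μ
  identDistrib : ∀ u, IdentDistrib (S u) (fun ω => (fun i => X i ω, fun j => Y j ω)) μ P₀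

/-- The size of the crumb with label `u`. -/
def crumb {Ω : Type*} (S : List ℕ → Ω → (ℕ → ℝ) × (ℕ → ℝ)) : List ℕ → Ω → ℝ
  | [], _ => 1
  | i :: u, ω => crumb S u ω * (S u ω).1 i

/-- The size of the solid with label `(u, j)`, the solid number `j` born from the crumb `u`.
The family of all these sizes is the paintbox. -/
def solid {Ω : Type*} (S : List ℕ → Ω → (ℕ → ℝ) × (ℕ → ℝ)) (c : List ℕ × ℕ) (ω : Ω) : ℝ :=
  crumb S c.1 ω * (S c.1 ω).2 c.2

/-- The random colours `C 0, C 1, …` of the balls are a sample from the random frequencies `P`: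
conditionally given `P`, they are independent, and each is `c` with probability `P c`. -/
structure IsPaintboxSample {Ω κ : Type*} [MeasurableSpace Ω] (μ : Measure Ω)
    (P : κ → Ω → ℝ) (C : ℕ → Ω → κ) : Prop where
  measurable_box : ∀ c, Measurable (P c)
  measurableSet_color : ∀ k c, MeasurableSet {ω | C k ω = c}
  cond_law : ∀ (n : ℕ) (c : Fin n → κ),
    μ⟦{ω | ∀ k : Fin n, C k ω = c k} |
        MeasurableSpace.comap (fun ω d => P d ω) MeasurableSpace.pi⟧
      =ᵐ[μ] fun ω => ∏ k, P (c k) ω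

/-- `K_n`: the number of different colours of the first `n` balls. -/
def numColors {Ω κ : Type*} [DecidableEq κ] (C : ℕ → Ω → κ) (n : ℕ) (ω : Ω) : ℕ :=
  ((Finset.range n).image fun k => C k ω).card

/-- `K_{nr}` for `r ≥ 1`: the number of colours represented exactly `r` times on the first `n`
balls. -/
def numColorsMult {Ω κ : Type*} [DecidableEq κ] (C : ℕ → Ω → κ) (n r : ℕ) (ω : Ω) : ℕ :=
  (((Finset.range n).image fun k => C k ω).filter fun c =>
    ((Finset.range n).filter fun k => C k ω = c).card = r).card

end RecursivePartition

open RecursivePartition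

/-! Everything depends on the frequencies only through the intensity measure `λ` of all solids.
Given the frequencies, a colour of frequency `x` shows up exactly `r` times with probability `choose
n r * x ^ r * (1 - x) ^ (n - r)`, and the ball after the first `m` brings that colour in for the
first time with probability `x * (1 - x) ^ m`. Hence `E K_{nr}` and `E K_n` are explicit integrals
against `λ`.

The Mellin transform of `λ` is a geometric series. A crumb is a product of independent factors along
its word, so summing over words gives `1 / (1 - ψ)`, and the last step, from crumb to solid,
contributes `φ`. Thus the transform is `φ / (1 - ψ)` on a line `Re s = c` with `α < c < 1`
(`IsDivision.mellinTransform_solid`).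

Up to a relative error of order `1 / n`, the binomial weight may be replaced by the Poisson weight
`(n x) ^ r * exp (-n x)`. By Mellin inversion, the integral of `(t x) ^ r * exp (-t x)` against `λ`
is a contour integral of `t ^ s * Γ(r - s) * φ(s) / (1 - ψ(s))`. The only pole in the half-plane is
at `α`; it is simple, with residue `A = -φ(α) / ψ'(α)`, and produces the main term `A * Γ(r - α) * t
^ α`. Its contribution is computed exactly with the model measure `powerMeasure α`; the holomorphic
remainder is integrated on the shifted line `Re s = α - δ` and costs `O(t ^ (α - δ))`.

The shift needs `1 / (1 - ψ)` to be bounded far up the strip. This follows from the uniqueness of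
`α` in the wider open half-plane: `1 - ψ` has no zeros on large discs away from `α`, is bounded
there, and is not small at their centres, so the Borel–Carathéodory inequality bounds it below
(`Malthusian.exists_le_norm_one_sub_psi`).

Finally, `E K_n` is obtained by summing the case `r = 1` over the number of balls. -/

namespace RecursivePartition

/-! ### Complex analysis: zero-free functions, vertical lines, decay of the gamma function -/

/-- A Harnack-type inequality: a bounded zero-free holomorphic function on a disc is bounded away
from zero on smaller concentric discs. -/
theorem norm_lower_bound_of_ne_zero {f : ℂ → ℂ} {c z : ℂ} {M m r R : ℝ} (hm : 0 < m)
    (hrR : r < R) (hf : DifferentiableOn ℂ f (Metric.ball c R))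
    (hf0 : ∀ w ∈ Metric.ball c R, f w ≠ 0) (hfM : ∀ w ∈ Metric.ball c R, ‖f w‖ ≤ M)
    (hfc : m ≤ ‖f c‖) (hz : z ∈ Metric.closedBall c r) :
    m * Real.exp (-(2 * (|Real.log (M / m)| + 1) * r / (R - r))) ≤ ‖f z‖ := by
  have hr : 0 ≤ r := dist_nonneg.trans hz
  have hR : 0 < R := hr.trans_lt hrR
  -- The added `1` makes `L` strictly positive, as the Borel–Carathéodory inequality requires.
  set L := |Real.log (M / m)| + 1 with hL
  have hL0 : 0 < L := by positivity
  have hdiff : ∀ w ∈ Metric.ball c R, DifferentiableAt ℂ f w := fun w hw =>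
    hf.differentiableAt (Metric.isOpen_ball.mem_nhds hw)
  -- `g` is a primitive of `f' / f` with `g c = 0`, that is, a logarithm of `f / f c`. An upper
  -- bound on its real part bounds its modulus.
  obtain ⟨g, hg0, hg⟩ := (DifferentiableOn.isExactOn_ball (f := fun w => deriv f w / f w)
    ((hf.deriv Metric.isOpen_ball).div hf hf0)).with_val_at c 0
  have hconst : ∀ w ∈ Metric.ball c R, f w * Complex.exp (-g w) = f c := by
    intro w hw
    have key := (convex_ball c R).is_const_of_fderivWithin_eq_zero (𝕜 := ℂ)
      (f := fun w => f w * Complex.exp (-g w)) ?_ ?_ hw (Metric.mem_ball_self hR)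
    · simpa [hg0] using key
    · intro v hv
      exact ((hdiff v hv).mul (hg v hv).differentiableAt.neg.cexp).differentiableWithinAt
    · intro v hv
      have h1 := (hdiff v hv).hasDerivAt.mul (hg v hv).neg.cexp
      have h2 : deriv f v * Complex.exp (-g v) +
          f v * (Complex.exp (-g v) * -(deriv f v / f v)) = 0 := by
        field_simp [hf0 v hv]
        ring
      have h3 : HasDerivAt (fun w => f w * Complex.exp (-g w)) 0 v := by
        rw [← h2]; exact h1
      rw [fderivWithin_of_isOpen Metric.isOpen_ball hv]
      have := h3.hasFDerivAt.fderiv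
      rw [this]; ext; simp
  have hexp : ∀ w ∈ Metric.ball c R, f w = f c * Complex.exp (g w) := by
    intro w hw
    rw [← hconst w hw, mul_assoc, ← Complex.exp_add]; simp
  have hnorm : ∀ w ∈ Metric.ball c R, ‖f w‖ = ‖f c‖ * Real.exp (g w).re := by
    intro w hw
    rw [hexp w hw, norm_mul, Complex.norm_exp]
  have hre : ∀ w ∈ Metric.ball c R, (g w).re ≤ L := by
    intro w hw
    have h1 : m * Real.exp (g w).re ≤ M := by
      refine le_trans ?_ (hfM w hw)
      rw [hnorm w hw]; gcongr
    have h2 : Real.exp (g w).re ≤ M / m := by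
      rw [le_div_iff₀ hm]; linarith
    have h3 := Real.log_le_log (Real.exp_pos _) h2
    rw [Real.log_exp] at h3
    exact h3.trans ((le_abs_self _).trans (by linarith))
  have hzR : z ∈ Metric.ball c R := lt_of_le_of_lt hz hrR
  have hball : ∀ w ∈ Metric.ball (0 : ℂ) R, c + w ∈ Metric.ball c R := by
    intro w hw
    simpa using hw
  have hmem : z - c ∈ Metric.ball (0 : ℂ) R := by
    simpa [dist_eq_norm] using hzR
  have hBC := Complex.borelCaratheodory_zero (f := fun w => g (c + w)) (z := z - c) hL0
    (fun w hw => ((hg _ (hball w hw)).differentiableAt.comp w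
      (by fun_prop)).differentiableWithinAt)
    (fun w hw => hre _ (hball w hw)) hR hmem (by simpa using hg0)
  simp only [add_sub_cancel] at hBC
  have hzc : ‖z - c‖ ≤ r := by simpa [dist_eq_norm] using hz
  have hbound : ‖g z‖ ≤ 2 * L * r / (R - r) := by
    refine hBC.trans ?_
    have : 0 < R - r := by linarith
    gcongr
  rw [hnorm z hzR]
  have h5 : -(2 * L * r / (R - r)) ≤ (g z).re := by
    have := (abs_le.mp (Complex.abs_re_le_norm (g z))).1
    linarith
  gcongr

theorem integrable_const_div_one_add_sq (C : ℝ) : Integrable fun y : ℝ => C / (1 + y ^ 2) := by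
  simpa [div_eq_mul_inv] using integrable_inv_one_add_sq.const_mul C

/-- A vertical line carrying a continuous function with quadratic decay can be integrated over. -/
theorem integrable_vertical {F : ℂ → ℂ} {a C : ℝ}
    (hF : ∀ z : ℂ, z.re = a → ContinuousAt F z)
    (hC : ∀ z : ℂ, z.re = a → ‖F z‖ ≤ C / (1 + z.im ^ 2)) :
    Integrable fun y : ℝ => F (a + y * Complex.I) := by
  refine (integrable_const_div_one_add_sq C).mono' ?_ (ae_of_all _ fun y => ?_)
  · refine (continuous_iff_continuousAt.mpr fun y => ?_).aestronglyMeasurable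
    exact ContinuousAt.comp (f := fun y : ℝ => (a + y * Complex.I : ℂ)) (hF _ (by simp))
      (by fun_prop)
  · simpa using hC (a + y * Complex.I) (by simp)

/-- Shift of the line of integration for a holomorphic function with quadratic decay on a vertical
strip. -/
theorem integral_vertical_eq {F : ℂ → ℂ} {a b C : ℝ} (hab : a ≤ b)
    (hF : ∀ z : ℂ, a ≤ z.re → z.re ≤ b → DifferentiableAt ℂ F z)
    (hC : ∀ z : ℂ, a ≤ z.re → z.re ≤ b → ‖F z‖ ≤ C / (1 + z.im ^ 2)) :
    ∫ y : ℝ, F (a + y * Complex.I) = ∫ y : ℝ, F (b + y * Complex.I) := by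
  have hia : Integrable fun y : ℝ => F (a + y * Complex.I) :=
    integrable_vertical (C := C) (fun z hz => (hF z hz.ge (hz.le.trans hab)).continuousAt)
      (fun z hz => hC z hz.ge (hz.le.trans hab))
  have hib : Integrable fun y : ℝ => F (b + y * Complex.I) :=
    integrable_vertical (C := C) (fun z hz => (hF z (hab.trans hz.ge) hz.le).continuousAt)
      (fun z hz => hC z (hab.trans hz.ge) hz.le)
  have hrect : ∀ T : ℝ, (∫ y in (-T)..T, F (b + y * Complex.I)) -
      (∫ y in (-T)..T, F (a + y * Complex.I)) =
      Complex.I * ((∫ x in a..b, F (x + (-T : ℝ) * Complex.I)) -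
        ∫ x in a..b, F (x + (T : ℝ) * Complex.I)) := by
    intro T
    have h := Complex.integral_boundary_rect_eq_zero_of_differentiableOn F
      (a + (-T : ℝ) * Complex.I) (b + T * Complex.I) (by
        intro z hz
        have h1 := hz.1
        simp only [Set.mem_preimage, Complex.add_re, Complex.ofReal_re, Complex.mul_re,
          Complex.I_re, Complex.ofReal_im, Complex.I_im, mul_zero, zero_mul, sub_zero,
          add_zero, Set.uIcc_of_le hab] at h1
        exact (hF z h1.1 h1.2).differentiableWithinAt)
    simp only [Complex.add_re, Complex.ofReal_re, Complex.mul_re, Complex.I_re, mul_zero,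
      Complex.ofReal_im, Complex.I_im, mul_one, sub_self, add_zero, Complex.add_im,
      Complex.mul_im, zero_add, smul_eq_mul] at h
    have hI : Complex.I * Complex.I = -1 := Complex.I_mul_I
    linear_combination (-Complex.I) * h + ((∫ y in (-T)..T, F (b + y * Complex.I)) -
      (∫ y in (-T)..T, F (a + y * Complex.I))) * hI
  have hhor : ∀ s : ℝ, ‖∫ x in a..b, F (x + (s : ℝ) * Complex.I)‖ ≤ C / (1 + s ^ 2) * |b - a| := by
    intro s
    refine intervalIntegral.norm_integral_le_of_norm_le_const fun x hx => ?_
    rw [Set.uIoc_of_le hab] at hx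
    simpa using hC (x + (s : ℝ) * Complex.I) (by simpa using hx.1.le) (by simpa using hx.2)
  have hlim1 := (intervalIntegral_tendsto_integral hib tendsto_neg_atTop_atBot tendsto_id).sub
    (intervalIntegral_tendsto_integral hia tendsto_neg_atTop_atBot tendsto_id)
  have hlim2 : Tendsto (fun T : ℝ => (∫ y in (-T)..T, F (b + y * Complex.I)) -
      (∫ y in (-T)..T, F (a + y * Complex.I))) atTop (nhds 0) := by
    have h0 : Tendsto (fun T : ℝ => 2 * (C / (1 + T ^ 2) * |b - a|)) atTop (nhds 0) := by
      have : Tendsto (fun T : ℝ => 1 + T ^ 2) atTop atTop :=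
        tendsto_atTop_add_const_left _ _ (tendsto_pow_atTop two_ne_zero)
      simpa using ((this.const_div_atTop C).mul_const |b - a|).const_mul 2
    refine squeeze_zero_norm (fun T => ?_) h0
    rw [hrect T, norm_mul, Complex.norm_I, one_mul]
    refine (norm_sub_le _ _).trans ?_
    have h1 := hhor (-T)
    have h2 := hhor T
    rw [neg_sq] at h1
    linarith
  exact (sub_eq_zero.mp (tendsto_nhds_unique hlim1 hlim2)).symm

theorem norm_Gamma_le_Gamma_re {z : ℂ} (hz : 0 < z.re) : ‖Complex.Gamma z‖ ≤ Real.Gamma z.re := by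
  rw [Complex.Gamma_eq_integral hz, Complex.GammaIntegral, Real.Gamma_eq_integral hz]
  refine norm_integral_le_of_norm_le (Real.GammaIntegral_convergent hz) ?_
  refine (ae_restrict_iff' measurableSet_Ioi).mpr (ae_of_all _ fun x hx => ?_)
  rw [norm_mul, Complex.norm_cpow_eq_rpow_re_of_pos hx]
  simp [Complex.norm_exp]

/-- Quadratic decay of the gamma function on closed vertical strips of the right half-plane. -/
theorem exists_norm_Gamma_le_div {a b : ℝ} (ha : 0 < a) :
    ∃ C, 0 ≤ C ∧ ∀ z : ℂ, a ≤ z.re → z.re ≤ b → ‖Complex.Gamma z‖ ≤ C / (1 + z.im ^ 2) := by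
  have hcont : ContinuousOn (fun x : ℝ => Real.Gamma (x + 2)) (Set.Icc a b) := by
    intro x hx
    have hx0 : 0 < x + 2 := by linarith [hx.1]
    have h1 : ContinuousAt Real.Gamma (x + 2) := (Real.differentiableAt_Gamma
      fun m => by have : (0 : ℝ) ≤ m := m.cast_nonneg
                  linarith).continuousAt
    exact (ContinuousAt.comp (f := fun x : ℝ => x + 2) h1 (by fun_prop)).continuousWithinAt
  obtain ⟨B, hB⟩ := isCompact_Icc.exists_bound_of_continuousOn hcont
  refine ⟨|B| / min (a ^ 2) 1, by positivity, fun z hza hzb => ?_⟩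
  have hz0 : z ≠ 0 := fun h => by simp [h] at hza; linarith
  have hz1 : z + 1 ≠ 0 := fun h => by
    have := congrArg Complex.re h
    simp at this; linarith
  -- Two steps of the functional equation gain the factor `z * (z + 1)`, whose modulus is at least a
  -- constant times `1 + z.im ^ 2`.
  have hrec : Complex.Gamma (z + 2) = (z + 1) * (z * Complex.Gamma z) := by
    rw [← Complex.Gamma_add_one z hz0, ← Complex.Gamma_add_one _ hz1]; ring_nf
  have hup : ‖Complex.Gamma (z + 2)‖ ≤ |B| := by
    have h1 := norm_Gamma_le_Gamma_re (z := z + 2) (by simp; linarith)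
    have h2 := hB z.re ⟨hza, hzb⟩
    simp only [Complex.add_re, Complex.re_ofNat] at h1
    exact h1.trans ((le_abs_self _).trans (h2.trans (le_abs_self _)))
  have hmin : 0 < min (a ^ 2) 1 := by positivity
  have hlow : min (a ^ 2) 1 * (1 + z.im ^ 2) ≤ ‖z + 1‖ * ‖z‖ := by
    have h1 : ‖z‖ ≤ ‖z + 1‖ := by
      rw [← sq_le_sq₀ (norm_nonneg _) (norm_nonneg _), Complex.sq_norm, Complex.sq_norm,
        Complex.normSq_apply, Complex.normSq_apply]
      simp; nlinarith
    have h2 : min (a ^ 2) 1 * (1 + z.im ^ 2) ≤ ‖z‖ ^ 2 := by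
      rw [Complex.sq_norm, Complex.normSq_apply]
      have h3 := min_le_left (a ^ 2) 1
      have h4 := min_le_right (a ^ 2) 1
      nlinarith [sq_nonneg z.im]
    nlinarith [norm_nonneg z]
  rw [div_div, le_div_iff₀ (by positivity)]
  calc ‖Complex.Gamma z‖ * (min (a ^ 2) 1 * (1 + z.im ^ 2))
      ≤ ‖Complex.Gamma z‖ * (‖z + 1‖ * ‖z‖) := by gcongr
    _ = ‖Complex.Gamma (z + 2)‖ := by rw [hrec, norm_mul, norm_mul]; ring
    _ ≤ |B| := hup

/-! ### Mellin transforms of measures on the positive half-line -/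

section MellinTransform

variable {m : Measure ℝ}

theorem integrable_rpow_of_le (hm : ∀ᵐ x ∂m, x ∈ Set.Ioc (0 : ℝ) 1) {a b : ℝ} (hab : a ≤ b)
    (ha : Integrable (fun x : ℝ => x ^ a) m) : Integrable (fun x : ℝ => x ^ b) m := by
  refine ha.mono' (by fun_prop) ?_
  filter_upwards [hm] with x hx
  rw [Real.norm_of_nonneg (Real.rpow_nonneg hx.1.le _)]
  exact Real.rpow_le_rpow_of_exponent_ge hx.1 hx.2 hab

theorem integral_rpow_anti (hm : ∀ᵐ x ∂m, x ∈ Set.Ioc (0 : ℝ) 1) {a b : ℝ} (hab : a ≤ b)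
    (ha : Integrable (fun x : ℝ => x ^ a) m) : ∫ x, x ^ b ∂m ≤ ∫ x, x ^ a ∂m := by
  refine integral_mono_ae (integrable_rpow_of_le hm hab ha) ha ?_
  filter_upwards [hm] with x hx
  exact Real.rpow_le_rpow_of_exponent_ge hx.1 hx.2 hab

theorem norm_ofReal_cpow_ae (hm : ∀ᵐ x ∂m, x ∈ Set.Ioi (0 : ℝ)) (s : ℂ) :
    ∀ᵐ x : ℝ ∂m, ‖(x : ℂ) ^ s‖ = x ^ s.re := by
  filter_upwards [hm] with x hx using Complex.norm_cpow_eq_rpow_re_of_pos hx s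

theorem integrable_cpow (hm : ∀ᵐ x ∂m, x ∈ Set.Ioi (0 : ℝ)) {s : ℂ}
    (hs : Integrable (fun x : ℝ => x ^ s.re) m) : Integrable (fun x : ℝ => (x : ℂ) ^ s) m := by
  refine hs.mono' (Complex.measurable_ofReal.pow_const s).aestronglyMeasurable ?_
  filter_upwards [norm_ofReal_cpow_ae hm s] with x hx using hx.le

theorem norm_mellinTransform_le (hm : ∀ᵐ x ∂m, x ∈ Set.Ioi (0 : ℝ)) (s : ℂ) :
    ‖mellinTransform m s‖ ≤ ∫ x, x ^ s.re ∂m := by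
  refine (norm_integral_le_integral_norm _).trans_eq (integral_congr_ae ?_)
  exact norm_ofReal_cpow_ae hm s

theorem mellinTransform_ofReal (hm : ∀ᵐ x ∂m, x ∈ Set.Ioi (0 : ℝ)) (a : ℝ) :
    mellinTransform m a = ((∫ x, x ^ a ∂m : ℝ) : ℂ) := by
  rw [mellinTransform, ← integral_complex_ofReal]
  refine integral_congr_ae ?_
  filter_upwards [hm] with x hx
  rw [Complex.ofReal_cpow (le_of_lt hx)]

/-- Since `x ^ s = exp (s * log x)`, holomorphy and the derivative formula are inherited from the
complex moment generating function of `log`. -/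
theorem mellinTransform_eq_complexMGF (hm : ∀ᵐ x ∂m, x ∈ Set.Ioi (0 : ℝ)) :
    mellinTransform m = complexMGF Real.log m := by
  ext s
  refine integral_congr_ae ?_
  filter_upwards [hm] with x hx
  have hx0 : (x : ℂ) ≠ 0 := by exact_mod_cast (ne_of_gt hx)
  rw [Complex.cpow_def_of_ne_zero hx0, Complex.ofReal_log (le_of_lt hx), mul_comm]

theorem mem_interior_integrableExpSet_log (hm : ∀ᵐ x ∂m, x ∈ Set.Ioi (0 : ℝ)) {a₀ a : ℝ}
    (hint : ∀ b : ℝ, a₀ < b → Integrable (fun x : ℝ => x ^ b) m) (ha : a₀ < a) :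
    a ∈ interior (integrableExpSet Real.log m) := by
  refine mem_interior.mpr ⟨Set.Ioi a₀, fun b hb => ?_, isOpen_Ioi, ha⟩
  refine (hint b hb).congr ?_
  filter_upwards [hm] with x hx
  rw [Real.rpow_def_of_pos hx, mul_comm]

theorem differentiableAt_mellinTransform (hm : ∀ᵐ x ∂m, x ∈ Set.Ioi (0 : ℝ)) {a₀ : ℝ}
    (hint : ∀ b : ℝ, a₀ < b → Integrable (fun x : ℝ => x ^ b) m) {s : ℂ} (hs : a₀ < s.re) :
    DifferentiableAt ℂ (mellinTransform m) s := by
  rw [mellinTransform_eq_complexMGF hm]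
  exact (hasDerivAt_complexMGF
    (mem_interior_integrableExpSet_log hm hint hs)).differentiableAt

/-- If the derivative of the Mellin transform of a measure on `(0, 1]` vanishes at a real point of
the open half-plane of convergence, then the measure is concentrated at `1`. -/
theorem ae_eq_one_of_deriv_mellinTransform_eq_zero (hm : ∀ᵐ x ∂m, x ∈ Set.Ioc (0 : ℝ) 1)
    {a₀ a : ℝ} (hint : ∀ b : ℝ, a₀ < b → Integrable (fun x : ℝ => x ^ b) m) (ha : a₀ < a)
    (hd : deriv (mellinTransform m) a = 0) : ∀ᵐ x ∂m, x = 1 := by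
  have hm' : ∀ᵐ x ∂m, x ∈ Set.Ioi (0 : ℝ) := hm.mono fun x hx => hx.1
  have hmem := mem_interior_integrableExpSet_log hm' hint ha
  have hder := hasDerivAt_complexMGF (X := Real.log) (μ := m) (z := a) (by simpa using hmem)
  rw [mellinTransform_eq_complexMGF hm', hder.deriv] at hd
  have hint1 : Integrable (fun x => Real.log x ^ 1 * Real.exp (a * Real.log x)) m :=
    integrable_pow_mul_exp_of_mem_interior_integrableExpSet hmem 1
  simp only [pow_one] at hint1
  have h0 : ∫ x, -(Real.log x * Real.exp (a * Real.log x)) ∂m = 0 := by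
    rw [integral_neg, neg_eq_zero]
    have : ((∫ x, Real.log x * Real.exp (a * Real.log x) ∂m : ℝ) : ℂ) = 0 := by
      rw [← hd, ← integral_complex_ofReal]
      push_cast
      rfl
    exact_mod_cast this
  have hint2 : Integrable (fun x => -(Real.log x * Real.exp (a * Real.log x))) m := hint1.neg
  rw [integral_eq_zero_iff_of_nonneg_ae _ hint2] at h0
  · filter_upwards [h0, hm] with x hx hx1
    have h2 : Real.log x = 0 := by
      simpa [Real.exp_ne_zero] using hx
    exact Real.eq_one_of_pos_of_log_eq_zero hx1.1 h2
  · filter_upwards [hm] with x hx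
    have := Real.log_nonpos hx.1.le hx.2
    simp only [Pi.zero_apply]
    nlinarith [Real.exp_pos (a * Real.log x)]

end MellinTransform

/-! ### Consequences of the Malthusian hypothesis -/

namespace Malthusian

variable {σ ν : Measure ℝ} {α ε : ℝ}

theorem integral_rpow_eq_one (hM : Malthusian σ ν α ε) (hσ : ∀ᵐ x ∂σ, x ∈ Set.Ioc (0 : ℝ) 1) :
    ∫ x, x ^ α ∂σ = 1 := by
  have := hM.psi_eq_one
  rw [mellinTransform_ofReal (hσ.mono fun x hx => hx.1)] at this
  exact_mod_cast this

/-- Monotonicity in the exponent gives `≤`; equality would be a second solution of `ψ s = 1`. -/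
theorem integral_rpow_lt_one (hM : Malthusian σ ν α ε) (hσ : ∀ᵐ x ∂σ, x ∈ Set.Ioc (0 : ℝ) 1)
    {a : ℝ} (ha : α < a) : ∫ x, x ^ a ∂σ < 1 := by
  have hε := hM.eps_pos
  refine lt_of_le_of_ne ?_ fun h => ?_
  · rw [← hM.integral_rpow_eq_one hσ]
    exact integral_rpow_anti hσ ha.le (hM.psi_finite α (by linarith))
  · have := hM.unique a (by simp; linarith) (by
      rw [mellinTransform_ofReal (hσ.mono fun x hx => hx.1), h]; simp)
    have h2 : a = α := by exact_mod_cast this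
    linarith

theorem differentiableAt_psi (hM : Malthusian σ ν α ε) (hσ : ∀ᵐ x ∂σ, x ∈ Set.Ioc (0 : ℝ) 1)
    {s : ℂ} (hs : α - ε < s.re) : DifferentiableAt ℂ (mellinTransform σ) s :=
  differentiableAt_mellinTransform (hσ.mono fun _ hx => hx.1) hM.psi_finite hs

theorem phi_integrable (hM : Malthusian σ ν α ε) (hν : ∀ᵐ x ∂ν, x ∈ Set.Ioc (0 : ℝ) 1)
    {a : ℝ} (ha : α - ε ≤ a) : Integrable (fun x : ℝ => x ^ a) ν :=
  integrable_rpow_of_le hν ha hM.phi_finite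

theorem differentiableAt_phi (hM : Malthusian σ ν α ε) (hν : ∀ᵐ x ∂ν, x ∈ Set.Ioc (0 : ℝ) 1)
    {s : ℂ} (hs : α - ε < s.re) : DifferentiableAt ℂ (mellinTransform ν) s :=
  differentiableAt_mellinTransform (hν.mono fun _ hx => hx.1)
    (fun _ hb => hM.phi_integrable hν hb.le) hs

/-- A vanishing derivative would concentrate `σ` at `1`, so `ψ` would take the same value at `α` and
`α + 1`, whereas it is less than `1` at `α + 1`. -/
theorem deriv_psi_ne_zero (hM : Malthusian σ ν α ε) (hσ : ∀ᵐ x ∂σ, x ∈ Set.Ioc (0 : ℝ) 1) :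
    deriv (mellinTransform σ) α ≠ 0 := by
  intro h
  have hε := hM.eps_pos
  have h1 := ae_eq_one_of_deriv_mellinTransform_eq_zero hσ hM.psi_finite (by linarith) h
  have h2 : ∫ x, x ^ (α + 1) ∂σ = ∫ x, x ^ α ∂σ := by
    refine integral_congr_ae ?_
    filter_upwards [h1] with x hx
    simp [hx]
  have h3 := hM.integral_rpow_lt_one hσ (a := α + 1) (by linarith)
  rw [h2, hM.integral_rpow_eq_one hσ] at h3
  exact lt_irrefl _ h3

/-- On a vertical strip inside the half-plane, `1 - ψ` is bounded away from zero far from the real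
axis. -/
theorem exists_le_norm_one_sub_psi (hM : Malthusian σ ν α ε)
    (hσ : ∀ᵐ x ∂σ, x ∈ Set.Ioc (0 : ℝ) 1) {δ : ℝ} (hδ0 : 0 < δ) (hδ : δ < ε) :
    ∃ κ T : ℝ, 0 < κ ∧ ∀ s : ℂ, α - δ ≤ s.re → s.re ≤ α + 1 → T ≤ |s.im| →
      κ ≤ ‖1 - mellinTransform σ s‖ := by
  have hσ' : ∀ᵐ x ∂σ, x ∈ Set.Ioi (0 : ℝ) := hσ.mono fun x hx => hx.1
  -- Discs about points of `Re s = α + 1` are used: radius `1 + δ'` stays inside the half-plane, and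
  -- the smaller radius `1 + δ` reaches the line `Re s = α - δ`.
  obtain ⟨δ', hδ', hδ'ε⟩ := exists_between hδ
  set q := ∫ x, x ^ (α + 1) ∂σ with hq
  have hq1 : q < 1 := hM.integral_rpow_lt_one hσ (by linarith)
  have hmpos : 0 < 1 - q := by linarith
  -- The height `1 + δ'` keeps `α`, the only zero of `1 - ψ`, outside the disc. At the centre, `‖1 -
  -- ψ‖ ≥ 1 - q`.
  refine ⟨(1 - q) * Real.exp (-(2 * (|Real.log ((1 + ∫ x, x ^ (α - δ') ∂σ) / (1 - q))| + 1) *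
    (1 + δ) / (1 + δ' - (1 + δ)))), 1 + δ', mul_pos hmpos (Real.exp_pos _), fun s hs1 hs2 hs3 => ?_⟩
  set c : ℂ := (α + 1 : ℝ) + s.im * Complex.I with hc
  have hre : ∀ w ∈ Metric.ball c (1 + δ'), α - δ' < w.re := by
    intro w hw
    have h1 : |(w - c).re| < 1 + δ' :=
      (Complex.abs_re_le_norm _).trans_lt (by simpa [dist_eq_norm] using hw)
    have h2 := (abs_lt.mp h1).1
    simp [hc] at h2
    linarith
  refine norm_lower_bound_of_ne_zero (f := fun s => 1 - mellinTransform σ s) (c := c) (z := s)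
    (M := 1 + ∫ x, x ^ (α - δ') ∂σ) (r := 1 + δ) (R := 1 + δ') hmpos (by linarith) ?_ ?_ ?_ ?_ ?_
  · intro w hw
    exact ((differentiableAt_const _).sub (hM.differentiableAt_psi hσ
      (by linarith [hre w hw]))).differentiableWithinAt
  · intro w hw h0
    have h1 := hM.unique w (by linarith [hre w hw]) (sub_eq_zero.mp h0).symm
    have h2 : |(w - c).im| < 1 + δ' :=
      (Complex.abs_im_le_norm _).trans_lt (by simpa [dist_eq_norm] using hw)
    simp [h1, hc] at h2
    linarith
  · intro w hw
    refine (norm_sub_le _ _).trans ?_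
    rw [norm_one]
    gcongr
    exact (norm_mellinTransform_le hσ' w).trans
      (integral_rpow_anti hσ (hre w hw).le (hM.psi_finite _ (by linarith)))
  · have h1 : ‖mellinTransform σ c‖ ≤ q := by
      simpa [hc] using norm_mellinTransform_le hσ' c
    have h2 := norm_sub_norm_le (1 : ℂ) (mellinTransform σ c)
    rw [norm_one] at h2
    linarith
  · rw [Metric.mem_closedBall, dist_eq_norm]
    have : s - c = ((s.re - (α + 1) : ℝ) : ℂ) := by
      apply Complex.ext <;> simp [hc]
    rw [this, Complex.norm_real, Real.norm_eq_abs, abs_le]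
    constructor <;> linarith

end Malthusian

/-! ### Mellin inversion for the exponential -/

theorem verticalIntegrable_Gamma {a : ℝ} (ha : 0 < a) :
    Integrable fun y : ℝ => Complex.Gamma (a + y * Complex.I) := by
  obtain ⟨C, -, hC⟩ := exists_norm_Gamma_le_div (b := a) ha
  refine integrable_vertical (C := C) (fun z hz => ?_) fun z hz => hC z hz.ge hz.le
  refine (Complex.differentiableAt_Gamma z fun m h => ?_).continuousAt
  have h1 := congrArg Complex.re h
  have : (0 : ℝ) ≤ m := m.cast_nonneg
  simp at h1
  linarith

theorem mellin_exp_neg {s : ℂ} (hs : 0 < s.re) :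
    mellin (fun x : ℝ => ((Real.exp (-x) : ℝ) : ℂ)) s = Complex.Gamma s := by
  rw [Complex.Gamma_eq_integral hs, Complex.GammaIntegral_eq_mellin]

/-- The inverse Mellin transform of the gamma function. -/
theorem exp_neg_eq_integral_Gamma {a x : ℝ} (ha : 0 < a) (hx : 0 < x) :
    ((Real.exp (-x) : ℝ) : ℂ) = (1 / (2 * Real.pi) : ℝ) *
      ∫ y : ℝ, (x : ℂ) ^ (-(a + y * Complex.I)) * Complex.Gamma (a + y * Complex.I) := by
  have heq : ∀ y : ℝ, mellin (fun x : ℝ => ((Real.exp (-x) : ℝ) : ℂ)) (a + y * Complex.I) =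
      Complex.Gamma (a + y * Complex.I) := fun y => mellin_exp_neg (by simpa using ha)
  have h := mellinInv_mellin_eq a (fun x : ℝ => ((Real.exp (-x) : ℝ) : ℂ)) hx ?_ ?_ ?_
  · rw [← h, mellinInv]
    simp only [heq, smul_eq_mul]
    rw [Complex.real_smul]
  · have := Complex.GammaIntegral_convergent (s := a) (by simpa using ha)
    refine this.congr_fun (fun x _ => ?_) measurableSet_Ioi
    simp only [smul_eq_mul]; rw [mul_comm]
  · rw [Complex.VerticalIntegrable]
    simp only [heq]
    exact verticalIntegrable_Gamma ha
  · fun_prop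

/-- A Mellin–Parseval formula: the integral of `(t x) ^ r * exp (- t x)` with respect to a measure
as a contour integral of its Mellin transform. -/
theorem integral_pow_mul_exp_eq_vertical {m : Measure ℝ} [SFinite m]
    (hm : ∀ᵐ x ∂m, x ∈ Set.Ioi (0 : ℝ)) {c t : ℝ} {r : ℕ} (hcr : c < r) (ht : 0 < t)
    (hint : Integrable (fun x : ℝ => x ^ c) m) :
    ∫ x, (((t * x) ^ r * Real.exp (-(t * x)) : ℝ) : ℂ) ∂m = (1 / (2 * Real.pi) : ℝ) *
      ∫ y : ℝ, (t : ℂ) ^ (r - ((r - c : ℝ) + y * Complex.I)) *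
        Complex.Gamma ((r - c : ℝ) + y * Complex.I) *
        mellinTransform m (r - ((r - c : ℝ) + y * Complex.I)) := by
  have ha : 0 < (r : ℝ) - c := by linarith
  have ht0 : (t : ℂ) ≠ 0 := by exact_mod_cast ht.ne'
  have hGam := verticalIntegrable_Gamma ha
  set w : ℝ → ℂ := fun y => ((r - c : ℝ) : ℂ) + y * Complex.I with hw
  have hre : ∀ y, ((r : ℂ) - w y).re = c := fun y => by simp [hw]
  have hpt : ∀ᵐ x ∂m, (((t * x) ^ r * Real.exp (-(t * x)) : ℝ) : ℂ) = (1 / (2 * Real.pi) : ℝ) *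
      ∫ y : ℝ, (t : ℂ) ^ (r - w y) * Complex.Gamma (w y) * (x : ℂ) ^ (r - w y) := by
    filter_upwards [hm] with x hx
    have hx0 : (x : ℂ) ≠ 0 := by exact_mod_cast (ne_of_gt hx)
    have htx : 0 < t * x := mul_pos ht hx
    rw [Complex.ofReal_mul, exp_neg_eq_integral_Gamma ha htx, mul_left_comm,
      ← integral_const_mul]
    congr 1
    refine integral_congr_ae (ae_of_all _ fun y => ?_)
    have h1 : (((t * x) ^ r : ℝ) : ℂ) * ((t * x : ℝ) : ℂ) ^ (-w y) =
        (t : ℂ) ^ (r - w y) * (x : ℂ) ^ (r - w y) := by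
      rw [← Complex.mul_cpow_ofReal_nonneg ht.le (le_of_lt hx), sub_eq_add_neg,
        ← Complex.ofReal_mul, Complex.cpow_add _ _ (by exact_mod_cast htx.ne'),
        Complex.cpow_natCast, Complex.ofReal_pow]
    simp only
    change _ * (_ ^ (-w y) * Complex.Gamma (w y)) = _
    rw [← mul_assoc, h1]; ring
  rw [integral_congr_ae hpt, integral_const_mul]
  congr 1
  rw [integral_integral_swap]
  · refine integral_congr_ae (ae_of_all _ fun y => ?_)
    simp only
    rw [integral_const_mul]
    rfl
  -- On this line `t ^ (r - w) * x ^ (r - w)` has modulus `t ^ c * x ^ c`, so a product majorant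
  -- justifies Fubini.
  · have hprod : Integrable (fun p : ℝ × ℝ => p.1 ^ c * (t ^ c * ‖Complex.Gamma (w p.2)‖))
        (m.prod volume) := hint.mul_prod (hGam.norm.const_mul (t ^ c))
    refine hprod.mono' ?_ ?_
    · have hΓm : AEStronglyMeasurable (fun p : ℝ × ℝ => Complex.Gamma (w p.2)) (m.prod volume) :=
        hGam.aestronglyMeasurable.comp_snd
      refine AEStronglyMeasurable.mul (AEStronglyMeasurable.mul ?_ hΓm) ?_
      · refine Measurable.aestronglyMeasurable ?_
        exact measurable_const.pow (by fun_prop)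
      · refine Measurable.aestronglyMeasurable ?_
        exact Measurable.pow (by fun_prop) (by fun_prop)
    · have : ∀ᵐ p : ℝ × ℝ ∂(m.prod volume), p.1 ∈ Set.Ioi (0 : ℝ) :=
        Measure.quasiMeasurePreserving_fst.ae hm
      filter_upwards [this] with p hp
      simp only [Function.uncurry]
      rw [norm_mul, norm_mul, Complex.norm_cpow_eq_rpow_re_of_pos ht,
        Complex.norm_cpow_eq_rpow_re_of_pos hp, hre]
      exact le_of_eq (by ring)

/-! ### A model measure carrying the pole at `α` -/

/-- The measure `x ^ (-α - 1) dx` on the unit interval, whose Mellin transform is `1 / (s - α)`. -/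
noncomputable def powerMeasure (α : ℝ) : Measure ℝ :=
  (volume.restrict (Set.Ioo 0 1)).withDensity fun x => ENNReal.ofReal (x ^ (-α - 1))

instance (α : ℝ) : SFinite (powerMeasure α) := by
  unfold powerMeasure; infer_instance

theorem ae_powerMeasure_pos (α : ℝ) : ∀ᵐ x ∂powerMeasure α, x ∈ Set.Ioi (0 : ℝ) := by
  have h : ∀ᵐ x ∂volume.restrict (Set.Ioo (0 : ℝ) 1), x ∈ Set.Ioi (0 : ℝ) :=
    (ae_restrict_mem measurableSet_Ioo).mono fun x hx => hx.1
  exact (withDensity_absolutelyContinuous _ _).ae_le h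

theorem integral_powerMeasure (α : ℝ) (f : ℝ → ℂ) :
    ∫ x, f x ∂powerMeasure α = ∫ x in (0 : ℝ)..1, ((x ^ (-α - 1) : ℝ) : ℂ) * f x := by
  rw [powerMeasure, integral_withDensity_eq_integral_toReal_smul (by fun_prop)
    (ae_of_all _ fun x => ENNReal.ofReal_lt_top),
    intervalIntegral.integral_of_le zero_le_one, integral_Ioc_eq_integral_Ioo]
  refine setIntegral_congr_fun measurableSet_Ioo fun x hx => ?_
  rw [ENNReal.toReal_ofReal (Real.rpow_nonneg hx.1.le _), Complex.real_smul]

theorem integrable_rpow_powerMeasure {α c : ℝ} (hc : α < c) :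
    Integrable (fun x : ℝ => x ^ c) (powerMeasure α) := by
  rw [powerMeasure, integrable_withDensity_iff (by fun_prop)
    (ae_of_all _ fun x => ENNReal.ofReal_lt_top)]
  have h : IntegrableOn (fun x : ℝ => x ^ (c - α - 1)) (Set.Ioo 0 1) :=
    (intervalIntegrable_iff_integrableOn_Ioo_of_le zero_le_one).mp
      (intervalIntegral.intervalIntegrable_rpow' (by linarith))
  refine h.congr_fun (fun x hx => ?_) measurableSet_Ioo
  simp only
  rw [ENNReal.toReal_ofReal (Real.rpow_nonneg hx.1.le _), ← Real.rpow_add hx.1]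
  ring_nf

theorem mellinTransform_powerMeasure {α : ℝ} {s : ℂ} (hs : α < s.re) :
    mellinTransform (powerMeasure α) s = 1 / (s - α) := by
  have hne : s - α ≠ 0 := fun h => by
    have := congrArg Complex.re h
    simp at this; linarith
  rw [mellinTransform, integral_powerMeasure]
  have h1 : ∫ x in (0 : ℝ)..1, ((x ^ (-α - 1) : ℝ) : ℂ) * (x : ℂ) ^ s =
      ∫ x in (0 : ℝ)..1, (x : ℂ) ^ (s - α - 1) := by
    refine intervalIntegral.integral_congr_ae (ae_of_all _ fun x hx => ?_)
    rw [Set.uIoc_of_le zero_le_one] at hx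
    have hx0 : (x : ℂ) ≠ 0 := by exact_mod_cast hx.1.ne'
    rw [Complex.ofReal_cpow hx.1.le, ← Complex.cpow_add _ _ hx0]
    congr 1
    push_cast
    ring
  rw [h1, integral_cpow (Or.inl (by simp; linarith))]
  simp [hne]

/-- The substitution `y = t * x` produces `t ^ α` times the gamma integral cut off at `t`. On the
missing tail `y ^ (-δ) ≤ t ^ (-δ)`, which gives the error. This replaces a residue computation. -/
theorem norm_integral_pow_mul_exp_powerMeasure_sub_le {α δ t : ℝ} {r : ℕ} (hα : α < r)
    (hδ : 0 < δ) (ht : 0 < t) :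
    ‖∫ x, (((t * x) ^ r * Real.exp (-(t * x)) : ℝ) : ℂ) ∂powerMeasure α -
      (Real.Gamma (r - α) * t ^ α : ℝ)‖ ≤ Real.Gamma (r - α + δ) * t ^ (α - δ) := by
  set g : ℝ → ℝ := fun y => Real.exp (-y) * y ^ ((r : ℝ) - α - 1) with hg
  have hgi : IntegrableOn g (Set.Ioi 0) := Real.GammaIntegral_convergent (by linarith)
  have h1 : ∫ x, (((t * x) ^ r * Real.exp (-(t * x)) : ℝ) : ℂ) ∂powerMeasure α =
      ((t ^ α * ∫ y in Set.Ioc 0 t, g y : ℝ) : ℂ) := by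
    rw [integral_powerMeasure]
    have h2 : ∀ x ∈ Set.uIcc (0 : ℝ) 1, ((x ^ (-α - 1) : ℝ) : ℂ) *
        (((t * x) ^ r * Real.exp (-(t * x)) : ℝ) : ℂ) =
        ((t ^ (α + 1) * ((fun y => y ^ r * Real.exp (-y) * y ^ (-α - 1)) (t * x)) : ℝ) : ℂ) := by
      intro x hx
      rw [Set.uIcc_of_le zero_le_one] at hx
      rw [← Complex.ofReal_mul]
      congr 1
      simp only
      rw [Real.mul_rpow ht.le hx.1]
      have h3 : t ^ (α + 1) * t ^ (-α - 1) = 1 := by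
        rw [← Real.rpow_add ht]; simp
      linear_combination (-(x ^ (-α - 1) * ((t * x) ^ r * Real.exp (-(t * x))))) * h3
    rw [intervalIntegral.integral_congr h2, intervalIntegral.integral_ofReal,
      intervalIntegral.integral_const_mul, intervalIntegral.integral_comp_mul_left
        (fun y => y ^ r * Real.exp (-y) * y ^ (-α - 1)) ht.ne',
      mul_zero, mul_one, intervalIntegral.integral_of_le ht.le, smul_eq_mul, ← mul_assoc]
    congr 2
    · rw [← Real.rpow_neg_one, ← Real.rpow_add ht]; ring_nf
    · refine setIntegral_congr_fun measurableSet_Ioc fun y hy => ?_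
      simp only [hg]
      rw [mul_comm (y ^ r), mul_assoc, ← Real.rpow_natCast, ← Real.rpow_add hy.1]
      ring_nf
  have h4 : Real.Gamma (r - α) = (∫ y in Set.Ioc 0 t, g y) + ∫ y in Set.Ioi t, g y := by
    rw [Real.Gamma_eq_integral (by linarith), ← setIntegral_union
      (Set.Ioc_disjoint_Ioi le_rfl) measurableSet_Ioi
      (hgi.mono_set Set.Ioc_subset_Ioi_self) (hgi.mono_set (Set.Ioi_subset_Ioi ht.le)),
      Set.Ioc_union_Ioi_eq_Ioi ht.le]
  have hgδ : IntegrableOn (fun y => Real.exp (-y) * y ^ ((r : ℝ) - α + δ - 1)) (Set.Ioi 0) :=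
    Real.GammaIntegral_convergent (by linarith)
  have h5 : ∫ y in Set.Ioi t, g y ≤ t ^ (-δ) * Real.Gamma (r - α + δ) := by
    rw [Real.Gamma_eq_integral (by linarith), ← integral_const_mul]
    refine le_trans ?_ (setIntegral_mono_set (hgδ.const_mul (t ^ (-δ))) ?_
      (Set.Ioi_subset_Ioi ht.le).eventuallyLE)
    · refine setIntegral_mono_on (hgi.mono_set (Set.Ioi_subset_Ioi ht.le))
        (IntegrableOn.mono_set (hgδ.const_mul (t ^ (-δ))) (Set.Ioi_subset_Ioi ht.le))
        measurableSet_Ioi fun y hy => ?_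
      have hy0 : 0 < y := ht.trans hy
      have h6 : y ^ ((r : ℝ) - α - 1) = y ^ (-δ) * y ^ ((r : ℝ) - α + δ - 1) := by
        rw [← Real.rpow_add hy0]; ring_nf
      have h7 : y ^ (-δ) ≤ t ^ (-δ) := Real.rpow_le_rpow_of_nonpos ht (le_of_lt hy) (by linarith)
      simp only [hg]
      rw [h6, mul_left_comm]
      gcongr
    · refine (ae_restrict_iff' measurableSet_Ioi).mpr (ae_of_all _ fun y hy => ?_)
      have hy0 : (0 : ℝ) < y := hy
      simp only [Pi.zero_apply]
      positivity
  have h8 : 0 ≤ ∫ y in Set.Ioi t, g y := by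
    refine setIntegral_nonneg measurableSet_Ioi fun y hy => ?_
    have hy0 : 0 < y := ht.trans hy
    simp only [hg]
    positivity
  rw [h1, ← Complex.ofReal_sub, Complex.norm_real, h4]
  have h9 : t ^ (α - δ) = t ^ α * t ^ (-δ) := by rw [← Real.rpow_add ht]; ring_nf
  have h10 : 0 < t ^ α := Real.rpow_pos_of_pos ht α
  rw [h9, Real.norm_eq_abs, abs_le]
  constructor <;> nlinarith

/-! ### Removal of the pole and shift of the contour -/

/-- The Laurent remainder `φ / (1 - ψ) - A / (s - α)` extends holomorphically to the whole
half-plane, and is bounded on vertical strips. -/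
theorem Malthusian.exists_remainder {σ ν : Measure ℝ} {α ε : ℝ} (hM : Malthusian σ ν α ε)
    (hσ : ∀ᵐ x ∂σ, x ∈ Set.Ioc (0 : ℝ) 1) (hν : ∀ᵐ x ∂ν, x ∈ Set.Ioc (0 : ℝ) 1) :
    ∃ G : ℂ → ℂ, (∀ s : ℂ, α - ε < s.re → DifferentiableAt ℂ G s) ∧
      (∀ s : ℂ, α - ε < s.re → s ≠ α → G s = mellinTransform ν s / (1 - mellinTransform σ s) -
        (-mellinTransform ν α / deriv (mellinTransform σ) α) / (s - α)) ∧
      ∀ δ : ℝ, 0 < δ → δ < ε → ∃ B : ℝ, 0 ≤ B ∧ ∀ s : ℂ, α - δ ≤ s.re → s.re ≤ α + 1 →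
        ‖G s‖ ≤ B := by
  have hε := hM.eps_pos
  set U : Set ℂ := {s | α - ε < s.re} with hU
  have hUo : IsOpen U := isOpen_lt continuous_const Complex.continuous_re
  have hαU : (α : ℂ) ∈ U := by simp [hU, hε]
  set D : ℂ → ℂ := fun s => 1 - mellinTransform σ s with hD
  have hDd : DifferentiableOn ℂ D U := fun s hs =>
    ((differentiableAt_const _).sub (hM.differentiableAt_psi hσ hs)).differentiableWithinAt
  have hDα : D α = 0 := by simp [hD, hM.psi_eq_one]
  have hDder : deriv D α = -deriv (mellinTransform σ) α := by
    simp [hD]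
  -- `E` is `(1 - ψ) / (s - α)` with its singularity removed. It has no zeros, because `α` is the
  -- only zero of `1 - ψ` and is simple.
  set E : ℂ → ℂ := dslope D α with hE
  have hEd : DifferentiableOn ℂ E U :=
    (Complex.differentiableOn_dslope (hUo.mem_nhds hαU)).mpr hDd
  have hEα : E α = -deriv (mellinTransform σ) α := by rw [hE, dslope_same, hDder]
  have hEne : ∀ s : ℂ, s ≠ α → E s = D s / (s - α) := fun s hs => by
    rw [hE, dslope_of_ne _ hs, slope_def_field, hDα, sub_zero]
  have hE0 : ∀ s ∈ U, E s ≠ 0 := by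
    intro s hs h0
    by_cases hsα : s = α
    · rw [hsα, hEα, neg_eq_zero] at h0
      exact hM.deriv_psi_ne_zero hσ h0
    · rw [hEne s hsα, div_eq_zero_iff] at h0
      rcases h0 with h0 | h0
      · exact hsα (hM.unique s hs (sub_eq_zero.mp h0).symm)
      · exact hsα (sub_eq_zero.mp h0)
  -- `H` equals `(s - α) * φ / (1 - ψ)` off `α`, and its value at `α` is the residue; the slope of
  -- `H` at `α` is therefore the required remainder.
  set H : ℂ → ℂ := fun s => mellinTransform ν s / E s with hH
  have hHd : DifferentiableOn ℂ H U := DifferentiableOn.div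
    (fun s hs => (hM.differentiableAt_phi hν hs).differentiableWithinAt) hEd hE0
  have hGd : DifferentiableOn ℂ (dslope H α) U :=
    (Complex.differentiableOn_dslope (hUo.mem_nhds hαU)).mpr hHd
  have hGeq : ∀ s : ℂ, α - ε < s.re → s ≠ α → dslope H α s =
      mellinTransform ν s / (1 - mellinTransform σ s) -
        (-mellinTransform ν α / deriv (mellinTransform σ) α) / (s - α) := by
    intro s hs hsα
    have h1 : s - α ≠ 0 := sub_ne_zero.mpr hsα
    have h2 : D s ≠ 0 := fun h => hsα (hM.unique s hs (sub_eq_zero.mp h).symm)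
    have h3 := hM.deriv_psi_ne_zero hσ
    rw [dslope_of_ne _ hsα, slope_def_field, hH]
    simp only
    rw [hEne s hsα, hEα]
    change _ = mellinTransform ν s / D s - _
    field_simp
  refine ⟨dslope H α, fun s hs => hGd.differentiableAt (hUo.mem_nhds hs), hGeq,
    fun δ hδ0 hδ => ?_⟩
  obtain ⟨κ, T, hκ, hlow⟩ := hM.exists_le_norm_one_sub_psi hσ hδ0 hδ
  -- Below height `T'` compactness bounds the remainder. Above it, `T` controls `1 / (1 - ψ)` and
  -- the `1` ensures `‖s - α‖ ≥ 1`.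
  set T' := max T 1 with hT'
  have hT1 : 1 ≤ T' := le_max_right _ _
  have hcomp : IsCompact (Set.Icc (α - δ) (α + 1) ×ℂ Set.Icc (-T') T') :=
    isCompact_Icc.reProdIm isCompact_Icc
  obtain ⟨B, hB⟩ := hcomp.exists_bound_of_continuousOn (f := dslope H α)
    (hGd.continuousOn.mono fun s hs => by
      have := hs.1.1
      simp only [hU, Set.mem_ofPred_eq]
      linarith)
  set A := ‖-mellinTransform ν α / deriv (mellinTransform σ) α‖ with hA
  have hφ0 : 0 ≤ ∫ x, x ^ (α - δ) ∂ν := by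
    refine integral_nonneg_of_ae ?_
    filter_upwards [hν] with x hx using Real.rpow_nonneg hx.1.le _
  refine ⟨|B| + ((∫ x, x ^ (α - δ) ∂ν) / κ + A), by positivity, fun s hs1 hs2 => ?_⟩
  by_cases him : |s.im| ≤ T'
  · have h1 := hB s ⟨⟨hs1, hs2⟩, abs_le.mp him⟩
    have h2 : 0 ≤ (∫ x, x ^ (α - δ) ∂ν) / κ + A := by positivity
    linarith [le_abs_self B]
  · push Not at him
    have hsα : s ≠ α := fun h => by
      rw [h] at him
      simp at him
      linarith
    have hs : α - ε < s.re := by linarith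
    rw [hGeq s hs hsα]
    refine (norm_sub_le _ _).trans ?_
    have h1 : ‖mellinTransform ν s / (1 - mellinTransform σ s)‖ ≤ (∫ x, x ^ (α - δ) ∂ν) / κ := by
      rw [norm_div]
      refine div_le_div₀ hφ0 ?_ hκ (hlow s hs1 hs2 ((le_max_left _ _).trans him.le))
      exact (norm_mellinTransform_le (hν.mono fun x hx => hx.1) s).trans
        (integral_rpow_anti hν hs1 (hM.phi_integrable hν (by linarith)))
    have h2 : ‖-mellinTransform ν α / deriv (mellinTransform σ) α / (s - α)‖ ≤ A := by
      rw [norm_div]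
      refine div_le_self (norm_nonneg _) ?_
      have := Complex.abs_im_le_norm (s - α)
      simp at this
      linarith
    linarith [abs_nonneg B]

/-- The renewal theorem with remainder: exponential averages of a measure with Mellin transform
`φ / (1 - ψ)`. -/
theorem Malthusian.norm_integral_pow_mul_exp_sub_le {σ ν lam : Measure ℝ} [SFinite lam]
    {α ε c δ : ℝ} {r : ℕ} (hM : Malthusian σ ν α ε)
    (hσ : ∀ᵐ x ∂σ, x ∈ Set.Ioc (0 : ℝ) 1) (hν : ∀ᵐ x ∂ν, x ∈ Set.Ioc (0 : ℝ) 1)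
    (hlam : ∀ᵐ x ∂lam, x ∈ Set.Ioi (0 : ℝ)) (hαc : α < c) (hcα : c ≤ α + 1) (hcr : c < r)
    (hint : Integrable (fun x : ℝ => x ^ c) lam)
    (hmel : ∀ s : ℂ, s.re = c →
      mellinTransform lam s = mellinTransform ν s / (1 - mellinTransform σ s))
    (hδ0 : 0 < δ) (hδ : δ < ε) :
    ∃ B : ℝ, ∀ t : ℝ, 0 < t →
      ‖∫ x, (((t * x) ^ r * Real.exp (-(t * x)) : ℝ) : ℂ) ∂lam -
        (-mellinTransform ν α / deriv (mellinTransform σ) α) *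
          (Real.Gamma (r - α) * t ^ α : ℝ)‖ ≤ B * t ^ (α - δ) := by
  have hε := hM.eps_pos
  obtain ⟨G, hGd, hGeq, hGb⟩ := hM.exists_remainder hσ hν
  obtain ⟨B, hB0, hB⟩ := hGb δ hδ0 hδ
  set A := -mellinTransform ν α / deriv (mellinTransform σ) α with hA
  have ha : 0 < (r : ℝ) - c := by linarith
  obtain ⟨C, hC0, hC⟩ := exists_norm_Gamma_le_div (b := r - α + δ) ha
  refine ⟨1 / (2 * Real.pi) * (∫ y : ℝ, C * B / (1 + y ^ 2)) + ‖A‖ * Real.Gamma (r - α + δ),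
    fun t ht => ?_⟩
  have ht0 : (t : ℂ) ≠ 0 := by exact_mod_cast ht.ne'
  have hpow : ∀ w : ℂ, ‖(t : ℂ) ^ ((r : ℂ) - w)‖ = t ^ ((r : ℝ) - w.re) := fun w => by
    rw [Complex.norm_cpow_eq_rpow_re_of_pos ht]; simp
  have hpowd : ∀ w : ℂ, DifferentiableAt ℂ (fun w : ℂ => (t : ℂ) ^ ((r : ℂ) - w)) w := fun w =>
    ((differentiableAt_const _).sub differentiableAt_id).const_cpow (Or.inl ht0)
  have hΓd : ∀ w : ℂ, (r : ℝ) - c ≤ w.re → DifferentiableAt ℂ Complex.Gamma w := fun w hw =>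
    Complex.differentiableAt_Gamma w fun m h => by
      have h1 := congrArg Complex.re h
      have : (0 : ℝ) ≤ m := m.cast_nonneg
      simp at h1
      linarith
  -- The contour variable is `w = r - s`: moving `Re w` right from `r - c` to `r - α + δ` moves `Re
  -- s` left from `c` to `α - δ`, while `Γ(w)` stays clear of its poles.
  set F : ℂ → ℂ := fun w => (t : ℂ) ^ ((r : ℂ) - w) * Complex.Gamma w * G (r - w) with hF
  have hFd : ∀ w : ℂ, (r : ℝ) - c ≤ w.re → w.re ≤ r - α + δ → DifferentiableAt ℂ F w := by
    intro w hw1 hw2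
    refine ((hpowd w).mul (hΓd w hw1)).mul ?_
    exact DifferentiableAt.comp (f := fun w : ℂ => (r : ℂ) - w) w (hGd _ (by simp; linarith))
      (by fun_prop)
  have hFn : ∀ w : ℂ, (r : ℝ) - c ≤ w.re → w.re ≤ r - α + δ →
      ‖F w‖ ≤ t ^ ((r : ℝ) - w.re) * (C * B / (1 + w.im ^ 2)) := by
    intro w hw1 hw2
    simp only [hF]
    rw [norm_mul, norm_mul, hpow, mul_assoc, mul_div_right_comm]
    gcongr
    · exact hC w hw1 hw2
    · exact hB _ (by simp; linarith) (by simp; linarith)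
  -- A bound uniform over the strip, needed only to shift the line; its dependence on `t` is
  -- irrelevant. The power of `t` is at most the larger of its values on the two edges.
  have hFC : ∀ w : ℂ, (r : ℝ) - c ≤ w.re → w.re ≤ r - α + δ →
      ‖F w‖ ≤ ((t ^ c + t ^ (α - δ)) * (C * B)) / (1 + w.im ^ 2) := by
    intro w hw1 hw2
    refine (hFn w hw1 hw2).trans (le_of_le_of_eq ?_ (mul_div_assoc _ _ _).symm)
    gcongr
    rcases le_total 1 t with h1 | h1
    · have := Real.rpow_le_rpow_of_exponent_le h1 (show (r : ℝ) - w.re ≤ c by linarith)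
      linarith [Real.rpow_nonneg ht.le (α - δ)]
    · have := Real.rpow_le_rpow_of_exponent_ge ht h1 (show α - δ ≤ (r : ℝ) - w.re by linarith)
      linarith [Real.rpow_nonneg ht.le c]
  set P : ℂ → ℂ := fun w => (t : ℂ) ^ ((r : ℂ) - w) * Complex.Gamma w *
    (1 / ((r : ℂ) - w - α)) with hP
  have hne : ∀ w : ℂ, w.re = r - c → (r : ℂ) - w - α ≠ 0 := fun w hw h => by
    have := congrArg Complex.re h
    simp [hw] at this
    linarith
  have hPi : Integrable fun y : ℝ => P ((r - c : ℝ) + y * Complex.I) := by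
    refine integrable_vertical (C := t ^ c * C * (1 / (c - α))) (fun w hw => ?_) fun w hw => ?_
    · refine (((hpowd w).mul (hΓd w hw.ge)).mul
        ((differentiableAt_const _).div (by fun_prop) (hne w hw))).continuousAt
    · simp only [hP]
      rw [norm_mul, norm_mul, hpow, hw, mul_div_right_comm, mul_div_assoc]
      have h1 : c - α ≤ ‖(r : ℂ) - w - α‖ := by
        have := (le_abs_self _).trans (Complex.abs_re_le_norm ((r : ℂ) - w - α))
        simp [hw] at this
        linarith
      have h2 : 0 < c - α := by linarith
      rw [sub_sub_cancel, norm_div, norm_one]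
      gcongr
      exact hC w hw.ge (by rw [hw]; linarith)
  have hFi : Integrable fun y : ℝ => F ((r - c : ℝ) + y * Complex.I) :=
    integrable_vertical (fun w hw => (hFd w hw.ge (by rw [hw]; linarith)).continuousAt)
      fun w hw => hFC w hw.ge (by rw [hw]; linarith)
  have hIlam : ∫ x, (((t * x) ^ r * Real.exp (-(t * x)) : ℝ) : ℂ) ∂lam =
      (1 / (2 * Real.pi) : ℝ) * (∫ y : ℝ, F ((r - c : ℝ) + y * Complex.I)) +
      A * ∫ x, (((t * x) ^ r * Real.exp (-(t * x)) : ℝ) : ℂ) ∂powerMeasure α := by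
    rw [integral_pow_mul_exp_eq_vertical hlam hcr ht hint,
      integral_pow_mul_exp_eq_vertical (ae_powerMeasure_pos α) hcr ht
        (integrable_rpow_powerMeasure hαc), mul_left_comm, ← mul_add]
    congr 1
    rw [← integral_const_mul, ← integral_add']
    · refine integral_congr_ae (ae_of_all _ fun y => ?_)
      have hre : ((r : ℂ) - ((r - c : ℝ) + y * Complex.I)).re = c := by simp
      simp only [Pi.add_apply, hF]
      rw [mellinTransform_powerMeasure (by rw [hre]; exact hαc), hmel _ hre,
        hGeq _ (by rw [hre]; linarith) fun h => by
          have := congrArg Complex.re h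
          rw [hre] at this
          simp at this
          linarith]
      ring
    · exact hFi
    · refine (hPi.const_mul A).congr (ae_of_all _ fun y => ?_)
      have hre : ((r : ℂ) - ((r - c : ℝ) + y * Complex.I)).re = c := by simp
      simp only [hP]
      rw [mellinTransform_powerMeasure (by rw [hre]; exact hαc)]
  have hshift := integral_vertical_eq (F := F) (a := r - c) (b := r - α + δ) (by linarith) hFd hFC
  have hmain : ‖∫ y : ℝ, F ((r - c : ℝ) + y * Complex.I)‖ ≤
      t ^ (α - δ) * ∫ y : ℝ, C * B / (1 + y ^ 2) := by
    rw [hshift, ← integral_const_mul]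
    refine norm_integral_le_of_norm_le ((integrable_const_div_one_add_sq _).const_mul _)
      (ae_of_all _ fun y => ?_)
    have := hFn ((r - α + δ : ℝ) + y * Complex.I) (by simp; linarith) (by simp)
    refine this.trans_eq ?_
    simp
    left
    ring_nf
  have hpow0 := norm_integral_pow_mul_exp_powerMeasure_sub_le (r := r) (hαc.trans hcr) hδ0 ht
  have hsplit : ∫ x, (((t * x) ^ r * Real.exp (-(t * x)) : ℝ) : ℂ) ∂lam -
      A * (Real.Gamma (r - α) * t ^ α : ℝ) =
      (1 / (2 * Real.pi) : ℝ) * (∫ y : ℝ, F ((r - c : ℝ) + y * Complex.I)) +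
      A * (∫ x, (((t * x) ^ r * Real.exp (-(t * x)) : ℝ) : ℂ) ∂powerMeasure α -
        (Real.Gamma (r - α) * t ^ α : ℝ)) := by
    rw [hIlam]; ring
  rw [hsplit]
  refine (norm_add_le _ _).trans ?_
  rw [norm_mul, norm_mul, Complex.norm_real, Real.norm_of_nonneg (by positivity), add_mul]
  refine add_le_add ?_ ?_
  · rw [mul_assoc, mul_comm (∫ y : ℝ, C * B / (1 + y ^ 2))]
    gcongr
  · rw [mul_assoc]
    gcongr

/-! ### Intensity measures of families of random variables -/

/-- The intensity measure of the positive terms of a family of random variables with an arbitrary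
index type. -/
noncomputable def familyIntensity {Ω ι : Type*} [MeasurableSpace Ω] (μ : Measure Ω)
    (Z : ι → Ω → ℝ) : Measure ℝ :=
  (Measure.sum fun i => μ.map (Z i)).restrict (Set.Ioi 0)

section Intensity

variable {Ω ι : Type*} [MeasurableSpace Ω] {μ : Measure Ω} {Z : ι → Ω → ℝ}

instance [Countable ι] [SFinite μ] : SFinite (familyIntensity μ Z) := by
  unfold familyIntensity; infer_instance

theorem lintegral_familyIntensity (hZ : ∀ i, Measurable (Z i)) {f : ℝ → ℝ≥0∞}
    (hf : Measurable f) (hf0 : ∀ x ≤ 0, f x = 0) :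
    ∫⁻ x, f x ∂familyIntensity μ Z = ∑' i, ∫⁻ ω, f (Z i ω) ∂μ := by
  rw [familyIntensity, ← lintegral_indicator measurableSet_Ioi]
  have h : (Set.Ioi (0 : ℝ)).indicator f = f := by
    ext x
    by_cases hx : x ∈ Set.Ioi (0 : ℝ)
    · simp [hx]
    · rw [Set.indicator_of_notMem hx, hf0 x (not_lt.mp hx)]
  rw [h, lintegral_sum_measure]
  exact tsum_congr fun i => lintegral_map hf (hZ i)

theorem ae_familyIntensity_pos (μ : Measure Ω) (Z : ι → Ω → ℝ) :
    ∀ᵐ x ∂familyIntensity μ Z, x ∈ Set.Ioi (0 : ℝ) :=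
  ae_restrict_mem measurableSet_Ioi

theorem ae_familyIntensity_mem_Ioc [Countable ι] (hZ : ∀ i, Measurable (Z i))
    (h : ∀ i, ∀ᵐ ω ∂μ, Z i ω ∈ Set.Icc (0 : ℝ) 1) :
    ∀ᵐ x ∂familyIntensity μ Z, x ∈ Set.Ioc (0 : ℝ) 1 := by
  have h1 : ∀ᵐ x ∂(Measure.sum fun i => μ.map (Z i)), x ∈ Set.Icc (0 : ℝ) 1 := by
    refine (Measure.ae_sum_iff' (p := fun x => x ∈ Set.Icc (0 : ℝ) 1) measurableSet_Icc).mpr ?_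
    intro i
    exact (ae_map_iff (p := fun x => x ∈ Set.Icc (0 : ℝ) 1) (hZ i).aemeasurable
      measurableSet_Icc).mpr (h i)
  filter_upwards [ae_restrict_of_ae h1, ae_restrict_mem measurableSet_Ioi] with x hx1 hx2
  exact ⟨hx2, hx1.2⟩

theorem lintegral_rpow_familyIntensity (hZ : ∀ i, Measurable (Z i)) {a : ℝ} (ha : 0 < a) :
    ∫⁻ x, ENNReal.ofReal x ^ a ∂familyIntensity μ Z =
      ∑' i, ∫⁻ ω, ENNReal.ofReal (Z i ω) ^ a ∂μ := by
  refine lintegral_familyIntensity hZ (by fun_prop) fun x hx => ?_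
  rw [ENNReal.ofReal_of_nonpos hx, ENNReal.zero_rpow_of_pos ha]

theorem integrable_rpow_iff_lintegral_ne_top {m : Measure ℝ} (hm : ∀ᵐ x ∂m, x ∈ Set.Ioi (0 : ℝ))
    {a : ℝ} : Integrable (fun x : ℝ => x ^ a) m ↔ ∫⁻ x, ENNReal.ofReal x ^ a ∂m ≠ ∞ := by
  have h0 : 0 ≤ᵐ[m] fun x : ℝ => x ^ a := by
    filter_upwards [hm] with x hx using Real.rpow_nonneg (le_of_lt hx) _
  rw [← lintegral_ofReal_ne_top_iff_integrable (by fun_prop) h0]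
  have : ∫⁻ x, ENNReal.ofReal (x ^ a) ∂m = ∫⁻ x, ENNReal.ofReal x ^ a ∂m := by
    refine lintegral_congr_ae ?_
    filter_upwards [hm] with x hx
    rw [ENNReal.ofReal_rpow_of_pos hx]
  rw [this]

theorem ofReal_integral_rpow {m : Measure ℝ} (hm : ∀ᵐ x ∂m, x ∈ Set.Ioi (0 : ℝ))
    {a : ℝ} (ha : Integrable (fun x : ℝ => x ^ a) m) :
    ENNReal.ofReal (∫ x, x ^ a ∂m) = ∫⁻ x, ENNReal.ofReal x ^ a ∂m := by
  have h0 : 0 ≤ᵐ[m] fun x : ℝ => x ^ a := by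
    filter_upwards [hm] with x hx using Real.rpow_nonneg (le_of_lt hx) _
  rw [ofReal_integral_eq_lintegral_ofReal ha h0]
  refine lintegral_congr_ae ?_
  filter_upwards [hm] with x hx
  rw [ENNReal.ofReal_rpow_of_pos hx]

/-- As `0 ^ s = 0` for `s ≠ 0`, labels without a piece contribute nothing, and the restriction to
positive sizes can be dropped. -/
theorem hasSum_mellinTransform_familyIntensity (hZ : ∀ i, Measurable (Z i))
    (h0 : ∀ i, ∀ᵐ ω ∂μ, 0 ≤ Z i ω) {s : ℂ} (hs : s ≠ 0)
    (hint : Integrable (fun x : ℝ => (x : ℂ) ^ s) (familyIntensity μ Z)) :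
    HasSum (fun i => ∫ ω, (Z i ω : ℂ) ^ s ∂μ) (mellinTransform (familyIntensity μ Z) s) := by
  rw [familyIntensity, Measure.restrict_sum _ measurableSet_Ioi] at hint
  have h := hasSum_integral_measure hint
  rw [mellinTransform, familyIntensity, Measure.restrict_sum _ measurableSet_Ioi]
  have key : ∀ i, ∫ ω, (Z i ω : ℂ) ^ s ∂μ =
      ∫ x in Set.Ioi 0, (x : ℂ) ^ s ∂(μ.map (Z i)) := ?_
  · simpa only [key] using h
  intro i
  have h1 : ∫ x in Set.Ioi 0, (x : ℂ) ^ s ∂(μ.map (Z i)) = ∫ x, (x : ℂ) ^ s ∂(μ.map (Z i)) := by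
    refine setIntegral_eq_integral_of_ae_compl_eq_zero ?_
    have h2 : ∀ᵐ x ∂(μ.map (Z i)), 0 ≤ x :=
      (ae_map_iff (hZ i).aemeasurable measurableSet_Ici).mpr (h0 i)
    filter_upwards [h2] with x hx hx'
    have : x = 0 := le_antisymm (not_lt.mp hx') hx
    simp [this, hs]
  rw [h1, integral_map (hZ i).aemeasurable
    (Complex.measurable_ofReal.pow_const s).aestronglyMeasurable]

end Intensity

/-! ### Geometric series over words -/

section Words

theorem tsum_prod_tuple {κ : Type*} {k : ℕ} (x : Fin k → κ → ℝ≥0∞) :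
    ∑' f : Fin k → κ, ∏ i, x i (f i) = ∏ i, ∑' d, x i d := by
  induction k with
  | zero => simp
  | succ k ih =>
    rw [← (Fin.consEquiv fun _ => κ).tsum_eq, ENNReal.tsum_prod']
    simp only [Fin.consEquiv_apply, Fin.prod_univ_succ, Fin.cons_zero, Fin.cons_succ]
    simp_rw [ENNReal.tsum_mul_left, ih, ENNReal.tsum_mul_right]

/-- Words of length `k` contribute the `k`-th power of the letter sum. If that sum is at least `1`,
both sides are `∞`. -/
theorem tsum_prod_word (x : ℕ → ℝ≥0∞) :
    ∑' u : List ℕ, (u.map x).prod = (1 - ∑' i, x i)⁻¹ := by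
  rw [← List.equivSigmaTuple.symm.tsum_eq, ENNReal.tsum_sigma', ← ENNReal.tsum_geometric]
  refine tsum_congr fun k => ?_
  have h := tsum_prod_tuple fun (_ : Fin k) => x
  rw [Finset.prod_const, Finset.card_fin] at h
  rw [← h]
  refine tsum_congr fun f => ?_
  simp [List.equivSigmaTuple, List.map_ofFn, List.prod_ofFn]

/-- Absolute convergence comes from the nonnegative case. Splitting off the first letter then gives
the equation `F = 1 + (∑' i, x i) * F` for the sum `F`. -/
theorem tsum_prod_word_complex {x : ℕ → ℂ} (hx : ∑' i, ‖x i‖ₑ < 1) :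
    Summable (fun u : List ℕ => ‖(u.map x).prod‖) ∧
      ∑' u : List ℕ, (u.map x).prod = (1 - ∑' i, x i)⁻¹ := by
  have hsum : Summable (fun u : List ℕ => ‖(u.map x).prod‖) := by
    have h1 : ∀ u : List ℕ, ‖(u.map x).prod‖ₑ = (u.map fun i => ‖x i‖ₑ).prod := by
      intro u
      induction u with
      | nil => simp
      | cons i u ih => simp [enorm_mul, ih]
    have h2 : ∑' u : List ℕ, ‖(u.map x).prod‖ₑ ≠ ∞ := by
      simp_rw [h1, tsum_prod_word]
      exact ENNReal.inv_ne_top.mpr (tsub_pos_of_lt hx).ne'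
    simpa using ENNReal.summable_toReal h2
  refine ⟨hsum, ?_⟩
  have hxs : Summable fun i => ‖x i‖ := by
    simpa using ENNReal.summable_toReal (hx.trans ENNReal.one_lt_top).ne
  set f : List ℕ → ℂ := fun u => (u.map x).prod with hf
  have h1 := hsum.of_norm.tsum_eq_add_tsum_ite []
  have hinj : Function.Injective fun p : ℕ × List ℕ => p.1 :: p.2 := by
    rintro ⟨i, u⟩ ⟨j, v⟩ h
    simpa using h
  have h2 : ∑' p : ℕ × List ℕ, x p.1 * f p.2 = ∑' u, if u = [] then 0 else f u := by
    rw [← hinj.tsum_eq (f := fun u => if u = [] then 0 else f u)]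
    · simp [hf]
    · intro u hu
      cases u with
      | nil => simp at hu
      | cons i u => exact ⟨(i, u), rfl⟩
  rw [← h2, ← tsum_mul_tsum_of_summable_norm hxs hsum] at h1
  have h3 : f [] = 1 := by simp [hf]
  change ∑' u, f u = f [] + (∑' i, x i) * ∑' u, f u at h1
  rw [h3] at h1
  refine eq_inv_of_mul_eq_one_right ?_
  linear_combination h1

end Words


/-! ### The intensity of the solids and its Mellin transform -/

theorem enorm_ofReal_cpow {x : ℝ} (hx : 0 ≤ x) {s : ℂ} (hs : 0 < s.re) :
    ‖(x : ℂ) ^ s‖ₑ = ENNReal.ofReal x ^ s.re := by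
  rw [← ofReal_norm, Complex.norm_cpow_eq_rpow_re_of_nonneg hx hs.ne',
    ENNReal.ofReal_rpow_of_nonneg hx hs.le]

/-- The size of a crumb involves only the splittings of strictly shorter words; this is what makes
it independent of its own splitting. -/
theorem measurable_crumb_iSup {Ω : Type*} (S : List ℕ → Ω → (ℕ → ℝ) × (ℕ → ℝ)) (u : List ℕ) :
    Measurable[⨆ v ∈ {v : List ℕ | v.length < u.length}, MeasurableSpace.comap (S v) inferInstance]
      (crumb S u) := by
  induction u with
  | nil => exact measurable_const
  | cons i u ih =>
    have h1 : (⨆ v ∈ {v : List ℕ | v.length < u.length},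
        MeasurableSpace.comap (S v) inferInstance) ≤
        ⨆ v ∈ {v : List ℕ | v.length < (i :: u).length},
          MeasurableSpace.comap (S v) inferInstance :=
      biSup_mono fun v hv => by
        simp only [Set.mem_ofPred_eq, List.length_cons] at hv ⊢
        omega
    have h2 : MeasurableSpace.comap (S u) inferInstance ≤
        ⨆ v ∈ {v : List ℕ | v.length < (i :: u).length},
          MeasurableSpace.comap (S v) inferInstance :=
      le_biSup (fun v => MeasurableSpace.comap (S v) inferInstance)
        (show u ∈ {v : List ℕ | v.length < (i :: u).length} by simp)
    refine Measurable.mul (ih.mono h1 le_rfl) ?_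
    have h3 : Measurable[MeasurableSpace.comap (S u) inferInstance] (S u) :=
      comap_measurable (S u)
    exact ((measurable_pi_apply i).comp (measurable_fst.comp h3)).mono h2 le_rfl

section Division

variable {Ω₀ Ω : Type*} [MeasurableSpace Ω₀] [MeasurableSpace Ω] {P₀ : Measure Ω₀}
  {μ : Measure Ω} {X Y : ℕ → Ω₀ → ℝ} {S : List ℕ → Ω → (ℕ → ℝ) × (ℕ → ℝ)}

namespace IsDivision

theorem measurable_crumb (hS : IsDivision P₀ X Y μ S) (u : List ℕ) : Measurable (crumb S u) :=
  (measurable_crumb_iSup S u).mono (iSup₂_le fun v _ => (hS.measurable v).comap_le) le_rfl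

theorem measurable_solid (hS : IsDivision P₀ X Y μ S) (c : List ℕ × ℕ) :
    Measurable (solid S c) :=
  (hS.measurable_crumb c.1).mul
    ((measurable_pi_apply c.2).comp (measurable_snd.comp (hS.measurable c.1)))

theorem indepFun_crumb (hS : IsDivision P₀ X Y μ S) (u : List ℕ) :
    IndepFun (crumb S u) (S u) μ := by
  have h := indep_iSup_of_disjoint (fun v => (hS.measurable v).comap_le) hS.indep
    (S := {v : List ℕ | v.length < u.length}) (T := {u}) (by simp)
  rw [IndepFun_iff_Indep]
  refine indep_of_indep_of_le_left (indep_of_indep_of_le_right h ?_)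
    (measurable_crumb_iSup S u).comap_le
  simp

theorem ae_mem_Icc (hS : IsDivision P₀ X Y μ S) (hXY : IsSplitting P₀ X Y) (u : List ℕ) :
    ∀ᵐ ω ∂μ, (∀ i, (S u ω).1 i ∈ Set.Icc (0 : ℝ) 1) ∧ ∀ j, (S u ω).2 j ∈ Set.Icc (0 : ℝ) 1 := by
  have h := (hS.identDistrib u).symm.ae_mem_snd
    (t := (Set.univ.pi fun _ => Set.Icc (0 : ℝ) 1) ×ˢ (Set.univ.pi fun _ => Set.Icc (0 : ℝ) 1))
    ((MeasurableSet.univ_pi fun _ => measurableSet_Icc).prod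
      (MeasurableSet.univ_pi fun _ => measurableSet_Icc)) (by
        filter_upwards [hXY.mem_Icc_X, hXY.mem_Icc_Y] with ω h1 h2
        exact ⟨fun i _ => h1 i, fun j _ => h2 j⟩)
  filter_upwards [h] with ω h
  exact ⟨fun i => h.1 i trivial, fun j => h.2 j trivial⟩

theorem ae_crumb_mem_Icc (hS : IsDivision P₀ X Y μ S) (hXY : IsSplitting P₀ X Y) (u : List ℕ) :
    ∀ᵐ ω ∂μ, crumb S u ω ∈ Set.Icc (0 : ℝ) 1 := by
  induction u with
  | nil => exact ae_of_all _ fun ω => by simp [crumb]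
  | cons i u ih =>
    filter_upwards [ih, hS.ae_mem_Icc hXY u] with ω h1 h2
    exact ⟨mul_nonneg h1.1 (h2.1 i).1, mul_le_one₀ h1.2 (h2.1 i).1 (h2.1 i).2⟩

theorem ae_solid_mem_Icc (hS : IsDivision P₀ X Y μ S) (hXY : IsSplitting P₀ X Y)
    (c : List ℕ × ℕ) : ∀ᵐ ω ∂μ, solid S c ω ∈ Set.Icc (0 : ℝ) 1 := by
  filter_upwards [hS.ae_crumb_mem_Icc hXY c.1, hS.ae_mem_Icc hXY c.1] with ω h1 h2
  exact ⟨mul_nonneg h1.1 (h2.2 _).1, mul_le_one₀ h1.2 (h2.2 _).1 (h2.2 _).2⟩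

theorem lintegral_mul_eq (hS : IsDivision P₀ X Y μ S) (hXY : IsSplitting P₀ X Y) (u : List ℕ)
    {p : (ℕ → ℝ) × (ℕ → ℝ) → ℝ} (hp : Measurable p) {a : ℝ} (ha : 0 < a) :
    ∫⁻ ω, ENNReal.ofReal (crumb S u ω * p (S u ω)) ^ a ∂μ =
      (∫⁻ ω, ENNReal.ofReal (crumb S u ω) ^ a ∂μ) *
        ∫⁻ ω, ENNReal.ofReal (p (fun i => X i ω, fun j => Y j ω)) ^ a ∂P₀ := by
  have hg : Measurable fun x : ℝ => ENNReal.ofReal x ^ a := by fun_prop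
  have h1 : ∫⁻ ω, ENNReal.ofReal (p (S u ω)) ^ a ∂μ =
      ∫⁻ ω, ENNReal.ofReal (p (fun i => X i ω, fun j => Y j ω)) ^ a ∂P₀ :=
    ((hS.identDistrib u).comp (hg.comp hp)).lintegral_eq
  rw [← h1]
  refine Eq.trans ?_ (lintegral_mul_eq_lintegral_mul_lintegral_of_indepFun''
    (hg.comp (hS.measurable_crumb u)).aemeasurable
    (hg.comp (hp.comp (hS.measurable u))).aemeasurable
    ((hS.indepFun_crumb u).comp hg (hg.comp hp)))
  refine lintegral_congr_ae ?_
  filter_upwards [hS.ae_crumb_mem_Icc hXY u] with ω h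
  rw [ENNReal.ofReal_mul h.1, ENNReal.mul_rpow_of_nonneg _ _ ha.le]

theorem integral_mul_eq (hS : IsDivision P₀ X Y μ S) (hXY : IsSplitting P₀ X Y) (u : List ℕ)
    {p : (ℕ → ℝ) × (ℕ → ℝ) → ℝ} (hp : Measurable p) (hp0 : ∀ᵐ ω ∂μ, 0 ≤ p (S u ω)) (s : ℂ) :
    ∫ ω, ((crumb S u ω * p (S u ω) : ℝ) : ℂ) ^ s ∂μ =
      (∫ ω, (crumb S u ω : ℂ) ^ s ∂μ) *
        ∫ ω, (p (fun i => X i ω, fun j => Y j ω) : ℂ) ^ s ∂P₀ := by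
  have hg : Measurable fun x : ℝ => (x : ℂ) ^ s := Complex.measurable_ofReal.pow_const s
  have h1 : ∫ ω, (p (S u ω) : ℂ) ^ s ∂μ =
      ∫ ω, (p (fun i => X i ω, fun j => Y j ω) : ℂ) ^ s ∂P₀ :=
    ((hS.identDistrib u).comp (hg.comp hp)).integral_eq
  rw [← h1]
  refine Eq.trans ?_ (IndepFun.integral_fun_mul_eq_mul_integral
    ((hS.indepFun_crumb u).comp hg (hg.comp hp))
    (hg.comp (hS.measurable_crumb u)).aestronglyMeasurable
    (hg.comp (hp.comp (hS.measurable u))).aestronglyMeasurable)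
  refine integral_congr_ae ?_
  filter_upwards [hS.ae_crumb_mem_Icc hXY u, hp0] with ω h h0
  rw [Complex.ofReal_mul, Complex.mul_cpow_ofReal_nonneg h.1 h0]

variable [IsProbabilityMeasure μ]

theorem lintegral_crumb (hS : IsDivision P₀ X Y μ S) (hXY : IsSplitting P₀ X Y) (u : List ℕ)
    {a : ℝ} (ha : 0 < a) : ∫⁻ ω, ENNReal.ofReal (crumb S u ω) ^ a ∂μ =
      (u.map fun i => ∫⁻ ω, ENNReal.ofReal (X i ω) ^ a ∂P₀).prod := by
  induction u with
  | nil => simp [crumb]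
  | cons i u ih =>
    have h := hS.lintegral_mul_eq hXY u (p := fun p => p.1 i) (by fun_prop) ha
    simp only [crumb, List.map_cons, List.prod_cons]
    rw [h, ih, mul_comm]

theorem integral_crumb (hS : IsDivision P₀ X Y μ S) (hXY : IsSplitting P₀ X Y) (u : List ℕ)
    (s : ℂ) : ∫ ω, (crumb S u ω : ℂ) ^ s ∂μ =
      (u.map fun i => ∫ ω, (X i ω : ℂ) ^ s ∂P₀).prod := by
  induction u with
  | nil => simp [crumb]
  | cons i u ih =>
    have h := hS.integral_mul_eq hXY u (p := fun p => p.1 i) (by fun_prop)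
      ((hS.ae_mem_Icc hXY u).mono fun ω h => (h.1 i).1) s
    simp only [crumb, List.map_cons, List.prod_cons]
    rw [h, ih, mul_comm]

/-- The Mellin transform of the intensity of the solids is finite on the real axis wherever the
transform of the crumbs is less than `1`. -/
theorem integrable_rpow_solid (hS : IsDivision P₀ X Y μ S) (hXY : IsSplitting P₀ X Y) {a : ℝ}
    (ha : 0 < a) (hX : Integrable (fun x : ℝ => x ^ a) (intensity P₀ X))
    (hX1 : ∫ x, x ^ a ∂intensity P₀ X < 1)
    (hY : Integrable (fun x : ℝ => x ^ a) (intensity P₀ Y)) :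
    Integrable (fun x : ℝ => x ^ a) (familyIntensity μ (solid S)) := by
  have hposX := ae_familyIntensity_pos P₀ X
  have hposY := ae_familyIntensity_pos P₀ Y
  rw [integrable_rpow_iff_lintegral_ne_top (ae_familyIntensity_pos μ (solid S)),
    lintegral_rpow_familyIntensity hS.measurable_solid ha, ENNReal.tsum_prod']
  have h1 : ∀ (u : List ℕ) (j : ℕ), ∫⁻ ω, ENNReal.ofReal (solid S (u, j) ω) ^ a ∂μ =
      (u.map fun i => ∫⁻ ω, ENNReal.ofReal (X i ω) ^ a ∂P₀).prod *
        ∫⁻ ω, ENNReal.ofReal (Y j ω) ^ a ∂P₀ := by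
    intro u j
    rw [← hS.lintegral_crumb hXY u ha]
    exact hS.lintegral_mul_eq hXY u (p := fun p => p.2 j) (by fun_prop) ha
  simp_rw [h1, ENNReal.tsum_mul_left, ENNReal.tsum_mul_right, tsum_prod_word]
  rw [← lintegral_rpow_familyIntensity hXY.measurable_X ha,
    ← lintegral_rpow_familyIntensity hXY.measurable_Y ha]
  refine ENNReal.mul_ne_top (ENNReal.inv_ne_top.mpr (tsub_pos_of_lt ?_).ne')
    ((integrable_rpow_iff_lintegral_ne_top hposY).mp hY)
  rw [← ofReal_integral_rpow hposX hX]
  exact ENNReal.ofReal_lt_one.mpr hX1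

/-- The Mellin transform of the intensity of the solids is `φ / (1 - ψ)`. -/
theorem mellinTransform_solid (hS : IsDivision P₀ X Y μ S) (hXY : IsSplitting P₀ X Y) {s : ℂ}
    (hs : 0 < s.re) (hX : Integrable (fun x : ℝ => x ^ s.re) (intensity P₀ X))
    (hX1 : ∫ x, x ^ s.re ∂intensity P₀ X < 1)
    (hY : Integrable (fun x : ℝ => x ^ s.re) (intensity P₀ Y)) :
    mellinTransform (familyIntensity μ (solid S)) s =
      mellinTransform (intensity P₀ Y) s / (1 - mellinTransform (intensity P₀ X) s) := by
  have hposX := ae_familyIntensity_pos P₀ X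
  have hposY := ae_familyIntensity_pos P₀ Y
  have hs0 : s ≠ 0 := fun h => by simp [h] at hs
  have hX0 : ∀ i, ∀ᵐ ω ∂P₀, 0 ≤ X i ω := fun i => hXY.mem_Icc_X.mono fun ω h => (h i).1
  have hY0 : ∀ i, ∀ᵐ ω ∂P₀, 0 ≤ Y i ω := fun i => hXY.mem_Icc_Y.mono fun ω h => (h i).1
  have hsol := hasSum_mellinTransform_familyIntensity hS.measurable_solid
    (fun c => (hS.ae_solid_mem_Icc hXY c).mono fun ω h => h.1) hs0
    (integrable_cpow (ae_familyIntensity_pos μ (solid S))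
      (hS.integrable_rpow_solid hXY hs hX hX1 hY))
  have hsX := hasSum_mellinTransform_familyIntensity hXY.measurable_X hX0 hs0
    (integrable_cpow hposX hX)
  have hsY := hasSum_mellinTransform_familyIntensity hXY.measurable_Y hY0 hs0
    (integrable_cpow hposY hY)
  have hnorm : ∀ {Z : ℕ → Ω₀ → ℝ}, (∀ i, Measurable (Z i)) → (∀ i, ∀ᵐ ω ∂P₀, 0 ≤ Z i ω) →
      ∑' i, ‖∫ ω, (Z i ω : ℂ) ^ s ∂P₀‖ₑ ≤
        ∫⁻ x, ENNReal.ofReal x ^ s.re ∂familyIntensity P₀ Z := by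
    intro Z hZ hZ0
    rw [lintegral_rpow_familyIntensity hZ hs]
    refine ENNReal.tsum_le_tsum fun i => (enorm_integral_le_lintegral_enorm _).trans_eq ?_
    refine lintegral_congr_ae ?_
    filter_upwards [hZ0 i] with ω h
    exact enorm_ofReal_cpow h hs
  have hXlt : ∑' i, ‖∫ ω, (X i ω : ℂ) ^ s ∂P₀‖ₑ < 1 := by
    refine (hnorm hXY.measurable_X hX0).trans_lt ?_
    rw [← ofReal_integral_rpow hposX hX]
    exact ENNReal.ofReal_lt_one.mpr hX1
  have hYsum : Summable fun j => ‖∫ ω, (Y j ω : ℂ) ^ s ∂P₀‖ := by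
    have h2 : ∑' i, ‖∫ ω, (Y i ω : ℂ) ^ s ∂P₀‖ₑ ≠ ∞ :=
      ne_top_of_le_ne_top ((integrable_rpow_iff_lintegral_ne_top hposY).mp hY)
        (hnorm hXY.measurable_Y hY0)
    simpa using ENNReal.summable_toReal h2
  obtain ⟨hw1, hw2⟩ := tsum_prod_word_complex hXlt
  have h1 : ∀ c : List ℕ × ℕ, ∫ ω, (solid S c ω : ℂ) ^ s ∂μ =
      (c.1.map fun i => ∫ ω, (X i ω : ℂ) ^ s ∂P₀).prod * ∫ ω, (Y c.2 ω : ℂ) ^ s ∂P₀ := by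
    intro c
    rw [← hS.integral_crumb hXY c.1 s]
    exact hS.integral_mul_eq hXY c.1 (p := fun p => p.2 c.2) (by fun_prop)
      ((hS.ae_mem_Icc hXY c.1).mono fun ω h => (h.2 _).1) s
  rw [← hsol.tsum_eq]
  simp_rw [h1]
  rw [← tsum_mul_tsum_of_summable_norm hw1 hYsum, hw2, hsX.tsum_eq, hsY.tsum_eq,
    div_eq_mul_inv, mul_comm]
  rfl

end IsDivision

end Division

/-! ### Sampling from random frequencies -/

section Paintbox

variable {Ω κ : Type*} {C : ℕ → Ω → κ}

/-- The event that, among the first `n` balls, the balls of colour `c` are exactly those in `A`. -/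
def exactEvent (C : ℕ → Ω → κ) (n : ℕ) (A : Finset (Fin n)) (c : κ) : Set Ω :=
  {ω | ∀ k : Fin n, C k ω = c ↔ k ∈ A}

namespace IsPaintboxSample

variable [MeasurableSpace Ω] {μ : Measure Ω} {P : κ → Ω → ℝ}

theorem measurableSet_cylinder (hC : IsPaintboxSample μ P C) {n : ℕ} (t : Fin n → κ) :
    MeasurableSet {ω | ∀ k : Fin n, C k ω = t k} := by
  have : {ω | ∀ k : Fin n, C k ω = t k} = ⋂ k : Fin n, {ω | C k ω = t k} := by
    ext; simp
  rw [this]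
  exact MeasurableSet.iInter fun k => hC.measurableSet_color k _

theorem measurableSet_exactEvent (hC : IsPaintboxSample μ P C) (n : ℕ) (A : Finset (Fin n))
    (c : κ) : MeasurableSet (exactEvent C n A c) := by
  have : exactEvent C n A c =
      ⋂ k : Fin n, if k ∈ A then {ω | C k ω = c} else {ω | C k ω = c}ᶜ := by
    ext ω
    simp only [exactEvent, Set.mem_ofPred_eq, Set.mem_iInter]
    refine forall_congr' fun k => ?_
    by_cases hk : k ∈ A <;> simp [hk]
  rw [this]
  refine MeasurableSet.iInter fun k => ?_
  split_ifs
  · exact hC.measurableSet_color k _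
  · exact (hC.measurableSet_color k _).compl

theorem measure_cylinder [IsProbabilityMeasure μ] (hC : IsPaintboxSample μ P C)
    (hP : ∀ c, ∀ᵐ ω ∂μ, P c ω ∈ Set.Icc (0 : ℝ) 1) {n : ℕ} (t : Fin n → κ) :
    μ {ω | ∀ k : Fin n, C k ω = t k} = ∫⁻ ω, ∏ k, ENNReal.ofReal (P (t k) ω) ∂μ := by
  have hle : MeasurableSpace.comap (fun ω d => P d ω) MeasurableSpace.pi ≤
      (inferInstance : MeasurableSpace Ω) :=
    (measurable_pi_lambda _ hC.measurable_box).comap_le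
  have hs := hC.measurableSet_cylinder t
  have h1 := integral_congr_ae (hC.cond_law n t)
  rw [integral_condExp hle, integral_indicator hs, setIntegral_const, smul_eq_mul, mul_one] at h1
  have hae : ∀ᵐ ω ∂μ, ∀ k, P (t k) ω ∈ Set.Icc (0 : ℝ) 1 := ae_all_iff.mpr fun k => hP _
  have h2 : ENNReal.ofReal (∫ ω, ∏ k, P (t k) ω ∂μ) = ∫⁻ ω, ENNReal.ofReal (∏ k, P (t k) ω) ∂μ :=
    ofReal_integral_eq_lintegral_ofReal (integrable_condExp.congr (hC.cond_law n t)) (by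
      filter_upwards [hae] with ω h
      exact Finset.prod_nonneg fun k _ => (h k).1)
  rw [← h1, ofReal_measureReal] at h2
  rw [h2]
  refine lintegral_congr_ae ?_
  filter_upwards [hae] with ω h
  exact ENNReal.ofReal_prod_of_nonneg fun k _ => (h k).1

/-- The box is a countable disjoint union of cylinders, and the sum over colour tuples of products
factors into a product of sums. -/
theorem measure_box [Countable κ] [IsProbabilityMeasure μ] (hC : IsPaintboxSample μ P C)
    (hP : ∀ c, ∀ᵐ ω ∂μ, P c ω ∈ Set.Icc (0 : ℝ) 1) {n : ℕ} (T : Fin n → Set κ) :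
    μ {ω | ∀ k : Fin n, C k ω ∈ T k} =
      ∫⁻ ω, ∏ k, ∑' d, (T k).indicator (fun d => ENNReal.ofReal (P d ω)) d ∂μ := by
  classical
  have hm : ∀ d, Measurable fun ω => ENNReal.ofReal (P d ω) := fun d =>
    (hC.measurable_box d).ennreal_ofReal
  have hpt : ∀ ω, ({ω | ∀ k : Fin n, C k ω ∈ T k} : Set Ω).indicator (1 : Ω → ℝ≥0∞) ω =
      ∑' t : Fin n → κ, (if ∀ k, t k ∈ T k then 1 else 0) *
        ({ω | ∀ k : Fin n, C k ω = t k} : Set Ω).indicator (1 : Ω → ℝ≥0∞) ω := by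
    intro ω
    rw [tsum_eq_single fun k : Fin n => C k ω]
    · simp [Set.indicator_apply]
    · intro t ht
      have : ¬ ∀ k : Fin n, C k ω = t k := fun h => ht (funext fun k => (h k).symm)
      simp [this]
  have hms : MeasurableSet {ω | ∀ k : Fin n, C k ω ∈ T k} := by
    have : {ω | ∀ k : Fin n, C k ω ∈ T k} = ⋂ k : Fin n, ⋃ d ∈ T k, {ω | C k ω = d} := by
      ext; simp
    rw [this]
    exact MeasurableSet.iInter fun k => MeasurableSet.biUnion (Set.to_countable _)
      fun d _ => hC.measurableSet_color k d
  rw [← lintegral_indicator_one hms]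
  simp_rw [hpt]
  rw [lintegral_tsum fun t => ((measurable_one.indicator
    (hC.measurableSet_cylinder t)).const_mul _).aemeasurable]
  have hterm : ∀ t : Fin n → κ, ∫⁻ ω, (if ∀ k, t k ∈ T k then 1 else 0) *
      ({ω | ∀ k : Fin n, C k ω = t k} : Set Ω).indicator (1 : Ω → ℝ≥0∞) ω ∂μ =
      ∫⁻ ω, ∏ k, (T k).indicator (fun d => ENNReal.ofReal (P d ω)) (t k) ∂μ := by
    intro t
    rw [lintegral_const_mul _ (measurable_one.indicator (hC.measurableSet_cylinder t)),
      lintegral_indicator_one (hC.measurableSet_cylinder t), hC.measure_cylinder hP t]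
    split_ifs with h
    · rw [one_mul]
      refine lintegral_congr fun ω => Finset.prod_congr rfl fun k _ => ?_
      rw [Set.indicator_of_mem (h k)]
    · push Not at h
      obtain ⟨k, hk⟩ := h
      rw [zero_mul, eq_comm]
      refine lintegral_eq_zero_of_ae_eq_zero (ae_of_all _ fun ω => ?_)
      exact Finset.prod_eq_zero (Finset.mem_univ k) (Set.indicator_of_notMem hk _)
  simp_rw [hterm, ← tsum_prod_tuple]
  rw [lintegral_tsum]
  intro t
  refine (Finset.measurable_prod _ fun k _ => ?_).aemeasurable
  by_cases hk : t k ∈ T k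
  · simpa [hk] using hm _
  · simp [hk]

/-- The law of one and of two balls shows that the total mass has first and second moments equal to
`1`, hence zero variance. Thus the sampling hypothesis alone forces the frequencies to sum to `1`.
-/
theorem ae_tsum_eq_one [Countable κ] [IsProbabilityMeasure μ] (hC : IsPaintboxSample μ P C)
    (hP : ∀ c, ∀ᵐ ω ∂μ, P c ω ∈ Set.Icc (0 : ℝ) 1) :
    ∀ᵐ ω ∂μ, ∑' c, ENNReal.ofReal (P c ω) = 1 := by
  have hm : Measurable fun ω => ∑' c, ENNReal.ofReal (P c ω) :=
    Measurable.tsum fun d => (hC.measurable_box d).ennreal_ofReal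
  have hpow : ∀ n : ℕ, ∫⁻ ω, (∑' c, ENNReal.ofReal (P c ω)) ^ n ∂μ = 1 := by
    intro n
    have h := hC.measure_box hP fun _ : Fin n => Set.univ
    simpa using h.symm
  have hle : ∀ x : ℝ≥0∞, 2 * x ≤ x ^ 2 + 1 := by
    intro x
    induction x with
    | top => simp
    | coe x =>
      have := two_mul_le_add_sq x 1
      rw [mul_one, one_pow] at this
      exact_mod_cast this
  have h1 := hpow 1
  simp only [pow_one] at h1
  have h2 : ∫⁻ ω, 2 * ∑' c, ENNReal.ofReal (P c ω) ∂μ = 2 := by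
    rw [lintegral_const_mul _ hm, h1, mul_one]
  have h3 : ∫⁻ ω, (∑' c, ENNReal.ofReal (P c ω)) ^ 2 + 1 ∂μ = 2 := by
    rw [lintegral_add_left (hm.pow_const 2), hpow 2]
    simp
    norm_num
  have h4 := ae_eq_of_ae_le_of_lintegral_le (ae_of_all μ fun ω => hle _) (by rw [h2]; simp)
    ((hm.pow_const 2).add_const 1).aemeasurable (by rw [h2, h3])
  have h5 := ae_lt_top hm (by rw [h1]; simp)
  filter_upwards [h4, h5] with ω h6 h7
  lift ∑' c, ENNReal.ofReal (P c ω) to NNReal using h7.ne with x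
  have h8 : 2 * x = x ^ 2 + 1 := by exact_mod_cast h6
  have h9 : 2 * (x : ℝ) = (x : ℝ) ^ 2 + 1 := by exact_mod_cast h8
  have h10 : (x : ℝ) = 1 := by nlinarith [sq_nonneg ((x : ℝ) - 1)]
  exact_mod_cast h10

/-- The event is a box with sides `{c}` on `A` and `{c}ᶜ` elsewhere; total mass `1` gives the latter
the conditional probability `1 - P c`. -/
theorem measure_exactEvent [Countable κ] [IsProbabilityMeasure μ] (hC : IsPaintboxSample μ P C)
    (hP : ∀ c, ∀ᵐ ω ∂μ, P c ω ∈ Set.Icc (0 : ℝ) 1) (n : ℕ) (A : Finset (Fin n)) (c : κ) :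
    μ (exactEvent C n A c) =
      ∫⁻ ω, ENNReal.ofReal (P c ω) ^ A.card * (1 - ENNReal.ofReal (P c ω)) ^ (n - A.card) ∂μ := by
  classical
  have h := hC.measure_box hP fun k : Fin n => if k ∈ A then {c} else {c}ᶜ
  have hset : exactEvent C n A c =
      {ω | ∀ k : Fin n, C k ω ∈ if k ∈ A then ({c} : Set κ) else {c}ᶜ} := by
    ext ω
    simp only [exactEvent, Set.mem_ofPred_eq]
    refine forall_congr' fun k => ?_
    by_cases hk : k ∈ A <;> simp [hk]
  rw [hset, h]
  refine lintegral_congr_ae ?_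
  filter_upwards [hC.ae_tsum_eq_one hP] with ω hω
  have h1 : ∑' d, ({c} : Set κ).indicator (fun d => ENNReal.ofReal (P d ω)) d =
      ENNReal.ofReal (P c ω) := by
    rw [tsum_eq_single c]
    · simp
    · intro d hd
      simp [hd]
  have h2 : ∑' d, ({c}ᶜ : Set κ).indicator (fun d => ENNReal.ofReal (P d ω)) d =
      1 - ENNReal.ofReal (P c ω) := by
    refine ENNReal.eq_sub_of_add_eq' ENNReal.one_ne_top ?_
    rw [← hω, ← h1, ← ENNReal.tsum_add]
    refine tsum_congr fun d => ?_
    by_cases hd : d = c <;> simp [hd]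
  have h3 : ∀ k : Fin n, ∑' d, ((if k ∈ A then ({c} : Set κ) else {c}ᶜ).indicator
      (fun d => ENNReal.ofReal (P d ω)) d) =
      if k ∈ A then ENNReal.ofReal (P c ω) else 1 - ENNReal.ofReal (P c ω) := by
    intro k
    split_ifs
    · exact h1
    · exact h2
  simp_rw [h3]
  rw [Finset.prod_ite, Finset.prod_const, Finset.prod_const]
  congr 2
  · simp
  · rw [Finset.filter_not, Finset.filter_mem_eq_inter, Finset.univ_inter,
      ← Finset.compl_eq_univ_sdiff, Finset.card_compl, Fintype.card_fin]

theorem tsum_measure_exactEvent [Countable κ] [IsProbabilityMeasure μ]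
    (hC : IsPaintboxSample μ P C) (hP : ∀ c, ∀ᵐ ω ∂μ, P c ω ∈ Set.Icc (0 : ℝ) 1) (n : ℕ)
    (A : Finset (Fin n)) (hA : A.card ≠ 0) :
    ∑' c, μ (exactEvent C n A c) =
      ∫⁻ x, ENNReal.ofReal x ^ A.card * (1 - ENNReal.ofReal x) ^ (n - A.card)
        ∂familyIntensity μ P := by
  rw [lintegral_familyIntensity hC.measurable_box (by fun_prop) fun x hx => by
    simp [ENNReal.ofReal_of_nonpos hx, hA]]
  exact tsum_congr fun c => hC.measure_exactEvent hP n A c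

end IsPaintboxSample

/-- Each colour is recorded by the unique set of positions where it occurs. Since `r ≠ 0`, colours
that do not occur contribute nothing. -/
theorem numColorsMult_eq_tsum [DecidableEq κ] (C : ℕ → Ω → κ) (n r : ℕ) (hr : r ≠ 0) (ω : Ω) :
    (numColorsMult C n r ω : ℝ≥0∞) =
      ∑' c, ∑ A ∈ Finset.powersetCard r (Finset.univ : Finset (Fin n)),
        (exactEvent C n A c).indicator 1 ω := by
  have hinner : ∀ c, ∑ A ∈ Finset.powersetCard r (Finset.univ : Finset (Fin n)),
      (exactEvent C n A c).indicator (1 : Ω → ℝ≥0∞) ω =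
      if ((Finset.range n).filter fun k => C k ω = c).card = r then 1 else 0 := by
    intro c
    have h1 : ∀ A : Finset (Fin n), (exactEvent C n A c).indicator (1 : Ω → ℝ≥0∞) ω =
        if (Finset.univ.filter fun k : Fin n => C k ω = c) = A then 1 else 0 := by
      intro A
      have h : ω ∈ exactEvent C n A c ↔ (Finset.univ.filter fun k : Fin n => C k ω = c) = A := by
        simp [exactEvent, Finset.ext_iff]
      by_cases hA : ω ∈ exactEvent C n A c
      · rw [Set.indicator_of_mem hA, if_pos (h.mp hA), Pi.one_apply]
      · rw [Set.indicator_of_notMem hA, if_neg (mt h.mpr hA)]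
    have h2 : ((Finset.range n).filter fun k => C k ω = c).card =
        (Finset.univ.filter fun k : Fin n => C k ω = c).card := by
      rw [Finset.card_filter, Finset.card_filter, Finset.sum_range]
    simp_rw [h1]
    rw [Finset.sum_ite_eq, h2]
    simp [Finset.mem_powersetCard]
  simp_rw [hinner]
  rw [tsum_eq_sum (s := (Finset.range n).image fun k => C k ω)]
  · rw [numColorsMult, Finset.card_filter]
    push_cast
    rfl
  · intro c hc
    have : ((Finset.range n).filter fun k => C k ω = c) = ∅ := by
      refine Finset.filter_eq_empty_iff.mpr fun k hk h => hc ?_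
      exact Finset.mem_image.mpr ⟨k, hk, h⟩
    simp [this, hr.symm]

/-- The last ball raises the count exactly when it is the only one of its colour so far. -/
theorem numColors_succ_eq [DecidableEq κ] (C : ℕ → Ω → κ) (n : ℕ) (ω : Ω) :
    (numColors C (n + 1) ω : ℝ≥0∞) = numColors C n ω +
      ∑' c, (exactEvent C (n + 1) {Fin.last n} c).indicator 1 ω := by
  have hev : ∀ c, ω ∈ exactEvent C (n + 1) {Fin.last n} c ↔
      c = C n ω ∧ C n ω ∉ (Finset.range n).image fun k => C k ω := by
    intro c
    simp only [exactEvent, Set.mem_ofPred_eq, Fin.forall_fin_succ', Finset.mem_singleton,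
      Fin.val_castSucc, Fin.val_last, Finset.mem_image, Finset.mem_range, not_exists, not_and]
    constructor
    · rintro ⟨h1, h2⟩
      have h3 : C n ω = c := h2.mpr trivial
      refine ⟨h3.symm, fun k hk h => ?_⟩
      have := (h1 ⟨k, hk⟩).mp (h.trans h3)
      exact (Fin.castSucc_lt_last _).ne this
    · rintro ⟨rfl, h⟩
      refine ⟨fun k => ⟨fun h1 => absurd h1 (h k k.2), fun h1 => ?_⟩, by simp⟩
      exact absurd h1 (Fin.castSucc_lt_last _).ne
  have htsum : ∑' c, (exactEvent C (n + 1) {Fin.last n} c).indicator (1 : Ω → ℝ≥0∞) ω =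
      if C n ω ∈ (Finset.range n).image fun k => C k ω then 0 else 1 := by
    rw [tsum_eq_single (C n ω)]
    · split_ifs with h
      · exact Set.indicator_of_notMem (fun h' => ((hev _).mp h').2 h) _
      · exact Set.indicator_of_mem ((hev _).mpr ⟨rfl, h⟩) _
    · intro c hc
      simp [hev, hc]
  rw [htsum, numColors, numColors, Finset.range_add_one, Finset.image_insert]
  split_ifs with h
  · rw [Finset.insert_eq_of_mem h, add_zero]
  · rw [Finset.card_insert_of_notMem h]
    push_cast
    rfl

namespace IsPaintboxSample

variable [MeasurableSpace Ω] {μ : Measure Ω} {P : κ → Ω → ℝ} [Countable κ] [DecidableEq κ]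

theorem measurable_numColorsMult (hC : IsPaintboxSample μ P C) (n r : ℕ) (hr : r ≠ 0) :
    Measurable fun ω => (numColorsMult C n r ω : ℝ≥0∞) := by
  simp_rw [numColorsMult_eq_tsum C n r hr]
  exact Measurable.tsum fun c => Finset.measurable_fun_sum _ fun A _ =>
    measurable_one.indicator (hC.measurableSet_exactEvent n A c)

theorem lintegral_numColorsMult [IsProbabilityMeasure μ] (hC : IsPaintboxSample μ P C)
    (hP : ∀ c, ∀ᵐ ω ∂μ, P c ω ∈ Set.Icc (0 : ℝ) 1) (n r : ℕ) (hr : r ≠ 0) :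
    ∫⁻ ω, (numColorsMult C n r ω : ℝ≥0∞) ∂μ = n.choose r *
      ∫⁻ x, ENNReal.ofReal x ^ r * (1 - ENNReal.ofReal x) ^ (n - r) ∂familyIntensity μ P := by
  have hmeas : ∀ (A : Finset (Fin n)) (c : κ),
      Measurable ((exactEvent C n A c).indicator (1 : Ω → ℝ≥0∞)) := fun A c =>
    measurable_one.indicator (hC.measurableSet_exactEvent n A c)
  simp_rw [numColorsMult_eq_tsum C n r hr]
  rw [lintegral_tsum fun c => (Finset.measurable_fun_sum _ fun A _ => hmeas A c).aemeasurable]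
  simp_rw [lintegral_finsetSum _ fun A _ => hmeas A _,
    lintegral_indicator_one (hC.measurableSet_exactEvent n _ _)]
  rw [Summable.tsum_finsetSum fun A _ => ENNReal.summable]
  rw [Finset.sum_congr rfl fun A hA => ?_, Finset.sum_const, Finset.card_powersetCard,
    Finset.card_fin, nsmul_eq_mul]
  have hcard := (Finset.mem_powersetCard.mp hA).2
  rw [hC.tsum_measure_exactEvent hP n A (by rw [hcard]; exact hr), hcard]

theorem measurable_numColors_and_lintegral [IsProbabilityMeasure μ]
    (hC : IsPaintboxSample μ P C)
    (hP : ∀ c, ∀ᵐ ω ∂μ, P c ω ∈ Set.Icc (0 : ℝ) 1) (n : ℕ) :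
    (Measurable fun ω => (numColors C n ω : ℝ≥0∞)) ∧
    ∫⁻ ω, (numColors C n ω : ℝ≥0∞) ∂μ = ∑ m ∈ Finset.range n,
      ∫⁻ x, ENNReal.ofReal x * (1 - ENNReal.ofReal x) ^ m ∂familyIntensity μ P := by
  induction n with
  | zero => simp [numColors]
  | succ n ih =>
    have hmeas : ∀ c, Measurable
        ((exactEvent C (n + 1) {Fin.last n} c).indicator (1 : Ω → ℝ≥0∞)) := fun c =>
      measurable_one.indicator (hC.measurableSet_exactEvent _ _ c)
    simp_rw [numColors_succ_eq]
    refine ⟨ih.1.add (Measurable.tsum hmeas), ?_⟩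
    rw [lintegral_add_left ih.1, ih.2, lintegral_tsum fun c => (hmeas c).aemeasurable,
      Finset.sum_range_succ]
    simp_rw [lintegral_indicator_one (hC.measurableSet_exactEvent _ _ _)]
    rw [hC.tsum_measure_exactEvent hP _ _ (by simp)]
    simp

end IsPaintboxSample

end Paintbox

/-! ### Poisson approximation of binomial weights -/

section Poissonization

/-- Raise `1 - x ^ 2 ≤ (1 - x) * exp x` to the power `m` and apply Bernoulli's inequality on the
left. -/
theorem exp_neg_sub_pow_le {x : ℝ} (hx0 : 0 ≤ x) (hx1 : x ≤ 1) (m : ℕ) :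
    Real.exp (-(m * x)) - (1 - x) ^ m ≤ m * x ^ 2 * Real.exp (-(m * x)) := by
  have h1 : 1 - x ^ 2 ≤ (1 - x) * Real.exp x := by
    nlinarith [Real.add_one_le_exp x]
  have h2 : 1 - m * x ^ 2 ≤ (1 - x ^ 2) ^ m := by
    have := one_add_mul_le_pow (a := -x ^ 2) (by nlinarith) m
    rw [← sub_eq_add_neg] at this
    linarith
  have h3 : (1 - x ^ 2) ^ m ≤ (1 - x) ^ m * Real.exp (m * x) := by
    rw [Real.exp_nat_mul, ← mul_pow]
    exact pow_le_pow_left₀ (by nlinarith) h1 m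
  have h4 : Real.exp (m * x) * Real.exp (-(m * x)) = 1 := by
    rw [← Real.exp_add]; simp
  have h5 := mul_le_mul_of_nonneg_right (h2.trans h3) (Real.exp_pos (-(m * x))).le
  rw [mul_assoc, h4] at h5
  linarith

theorem pow_one_sub_le_exp {x : ℝ} (hx1 : x ≤ 1) (m : ℕ) :
    (1 - x) ^ m ≤ Real.exp (-(m * x)) := by
  have h := pow_le_pow_left₀ (by linarith) (Real.one_sub_le_exp_neg x) m
  rwa [← Real.exp_nat_mul, mul_neg] at h

theorem pow_sub_descFactorial_le {n r : ℕ} (hn : 1 ≤ n) (hrn : r ≤ n) :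
    (n : ℝ) ^ r - n.descFactorial r ≤ r ^ 2 / n * (n : ℝ) ^ r := by
  have hn0 : (0 : ℝ) < n := by exact_mod_cast hn
  have hrn' : (r : ℝ) ≤ n := by exact_mod_cast hrn
  have h1 : ((n : ℝ) + 1 - r) ^ r ≤ n.descFactorial r := by
    have := Nat.pow_sub_le_descFactorial n r
    have h : ((n + 1 - r : ℕ) : ℝ) = (n : ℝ) + 1 - r := by
      rw [Nat.cast_sub (by omega)]; push_cast; ring
    rw [← h]
    exact_mod_cast this
  have h2 : ((n : ℝ) - r) ^ r ≤ ((n : ℝ) + 1 - r) ^ r :=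
    pow_le_pow_left₀ (by linarith) (by linarith) r
  have h3 : ((n : ℝ) - r) ^ r = (1 + -(r / n : ℝ)) ^ r * (n : ℝ) ^ r := by
    rw [← mul_pow]
    congr 1
    field_simp
    ring
  have h4 : (r : ℝ) / n ≤ 1 := (div_le_one hn0).mpr hrn'
  have h5 := one_add_mul_le_pow (a := -(r / n : ℝ)) (by linarith) r
  have h6 := mul_le_mul_of_nonneg_right h5 (pow_pos hn0 r).le
  have h7 : (r : ℝ) * -(r / n : ℝ) = -(r ^ 2 / n) := by ring
  rw [h7] at h6
  nlinarith

/-- Poisson approximation of the binomial probabilities. -/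
theorem abs_descFactorial_mul_sub_le {n r : ℕ} (hn : 1 ≤ n) (hrn : r ≤ n) {x : ℝ} (hx0 : 0 ≤ x)
    (hx1 : x ≤ 1) :
    |n.descFactorial r * (x ^ r * (1 - x) ^ (n - r)) - (n * x) ^ r * Real.exp (-(n * x))| ≤
      Real.exp r * (r ^ 2 + r + 1) / n *
        ((n * x) ^ r * Real.exp (-(n * x)) + (n * x) ^ (r + 1) * Real.exp (-(n * x)) +
          (n * x) ^ (r + 2) * Real.exp (-(n * x))) := by
  have hn0 : (0 : ℝ) < n := by exact_mod_cast hn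
  obtain ⟨m, rfl⟩ : ∃ m, n = r + m := ⟨n - r, by omega⟩
  rw [Nat.add_sub_cancel_left]
  set n := r + m with hnm
  have hnm' : (n : ℝ) = r + m := by rw [hnm]; push_cast; rfl
  have hr0 : (0 : ℝ) ≤ r := r.cast_nonneg
  have hm0 : (0 : ℝ) ≤ m := m.cast_nonneg
  set p := (1 - x) ^ m with hp
  set e := Real.exp (-(m * x)) with he
  set E := Real.exp (-(n * x)) with hE
  set y := (n : ℝ) * x with hy
  have hy0 : 0 ≤ y := by positivity
  have hp0 : 0 ≤ p := pow_nonneg (by linarith) m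
  have hpe : p ≤ e := pow_one_sub_le_exp hx1 m
  have hep : e - p ≤ m * x ^ 2 * e := exp_neg_sub_pow_le hx0 hx1 m
  have hE0 : 0 < E := Real.exp_pos _
  have he0 : 0 < e := Real.exp_pos _
  have hEe : E = e * Real.exp (-(r * x)) := by
    rw [hE, he, ← Real.exp_add, hy, hnm']; ring_nf
  have hEle : E ≤ e := by
    rw [hEe]
    exact mul_le_of_le_one_right he0.le (Real.exp_le_one_iff.mpr (by nlinarith))
  -- As `n = m + r` and `x ≤ 1`, the two exponents differ by at most `r`; this is the source of the
  -- factor `exp r`.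
  have heE : e ≤ Real.exp r * E := by
    rw [hE, he, ← Real.exp_add]
    refine Real.exp_le_exp.mpr ?_
    rw [hy, hnm']
    nlinarith
  have hdiff : e - E ≤ r * x * e := by
    have := Real.one_sub_le_exp_neg (r * x)
    rw [hEe]
    nlinarith
  set d := (n.descFactorial r : ℝ) with hd
  have hd1 : d ≤ (n : ℝ) ^ r := by
    rw [hd]
    exact_mod_cast Nat.descFactorial_le_pow n r
  have hd2 := pow_sub_descFactorial_le hn hrn
  set N := (n : ℝ) ^ r with hN
  have hN0 : 0 < N := pow_pos hn0 r
  have hd0 : 0 ≤ d := Nat.cast_nonneg _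
  have hyr : y ^ r = N * x ^ r := by rw [hy, mul_pow]
  have hxr : 0 ≤ x ^ r := pow_nonneg hx0 r
  have hxy : x = y / n := by rw [hy]; field_simp
  have hmx : m * x ^ 2 ≤ y ^ 2 / n := by
    rw [hy, mul_pow, sq (n : ℝ), mul_assoc, mul_div_assoc, mul_div_cancel_left₀ _ hn0.ne']
    have : (m : ℝ) ≤ n := by rw [hnm']; linarith
    gcongr
  have hrhs : Real.exp r * (r ^ 2 + r + 1) / n * (y ^ r * E + y ^ (r + 1) * E + y ^ (r + 2) * E) =
      N * x ^ r * (Real.exp r * E * ((r ^ 2 + r + 1) / n * (1 + y + y ^ 2))) := by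
    rw [← hyr]; ring
  -- Three relative errors: falling factorial against power, exponent `m` against `n`, and `(1 - x)
  -- ^ m` against its exponential. With `x = y / n`, each is `1 / n` times a polynomial in `y`.
  have hmid : r ^ 2 / n + r * x + m * x ^ 2 ≤ ((r : ℝ) ^ 2 + r + 1) / n * (1 + y + y ^ 2) := by
    have h1 : ((r : ℝ) ^ 2 + r + 1) / n * (1 + y + y ^ 2) = r ^ 2 / n + r * (y / n) + y ^ 2 / n +
        (r + 1 + (r ^ 2 + 1) * y + (r ^ 2 + r) * y ^ 2) / n := by
      field_simp
      ring
    have h2 : 0 ≤ (r + 1 + (r ^ 2 + 1) * y + ((r : ℝ) ^ 2 + r) * y ^ 2) / n := by positivity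
    rw [h1, ← hxy]
    linarith
  have hfin : e * (r ^ 2 / n + r * x + m * x ^ 2) ≤
      Real.exp r * E * (((r : ℝ) ^ 2 + r + 1) / n * (1 + y + y ^ 2)) :=
    mul_le_mul heE hmid (by positivity) (by positivity)
  rw [hrhs, hyr]
  have hup : d * p - N * E ≤ N * (e * (r ^ 2 / n + r * x + m * x ^ 2)) := by
    have h1 : d * p ≤ N * e := mul_le_mul hd1 hpe hp0 hN0.le
    have h2 : N * (e - E) ≤ N * (r * x * e) := by gcongr
    have h3 : 0 ≤ N * (e * (r ^ 2 / n + m * x ^ 2)) := by positivity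
    linarith
  have hlow : N * E - d * p ≤ N * (e * (r ^ 2 / n + r * x + m * x ^ 2)) := by
    have h1 : (N - d) * p ≤ r ^ 2 / n * N * e := by
      refine mul_le_mul hd2 hpe hp0 (by positivity)
    have h2 : N * (e - p) ≤ N * (m * x ^ 2 * e) := by gcongr
    have h3 : N * E ≤ N * e := by gcongr
    have h4 : 0 ≤ N * (e * (r * x)) := by positivity
    linarith
  have hmul := mul_le_mul_of_nonneg_left hfin (mul_nonneg hN0.le hxr)
  have hup' := mul_le_mul_of_nonneg_left hup hxr
  have hlow' := mul_le_mul_of_nonneg_left hlow hxr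
  rw [abs_le]
  constructor <;> linarith

end Poissonization

/-! ### Sums of powers -/

section PowerSums

theorem rpow_le_tangent {a b β : ℝ} (ha : 0 < a) (hb : 0 ≤ b) (hβ0 : 0 ≤ β) (hβ1 : β ≤ 1) :
    b ^ β ≤ a ^ β + β * a ^ (β - 1) * (b - a) := by
  have h1 := rpow_one_add_le_one_add_mul_self (s := b / a - 1) (p := β)
    (by have := div_nonneg hb ha.le; linarith) hβ0 hβ1
  rw [add_sub_cancel, Real.div_rpow hb ha.le, div_le_iff₀ (Real.rpow_pos_of_pos ha β)] at h1
  refine h1.trans_eq ?_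
  rw [Real.rpow_sub_one ha.ne']
  field_simp

/-- Concavity of `x ^ β` bounds its increments by tangents, and the bounds telescope. The lower
bound is proved with `n + 1` in place of `n`, where the induction closes. -/
theorem sum_rpow_bounds {β : ℝ} (hβ0 : 0 < β) (hβ1 : β ≤ 1) (n : ℕ) :
    ((n : ℝ) ^ β - 1) / β ≤ ∑ m ∈ Finset.range n, ((m : ℝ) + 1) ^ (β - 1) ∧
      ∑ m ∈ Finset.range n, ((m : ℝ) + 1) ^ (β - 1) ≤ (n : ℝ) ^ β / β := by
  have hstrong : (((n : ℝ) + 1) ^ β - 1) / β ≤ ∑ m ∈ Finset.range n, ((m : ℝ) + 1) ^ (β - 1) := by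
    induction n with
    | zero => simp
    | succ n ih =>
      rw [Finset.sum_range_succ]
      have h := rpow_le_tangent (a := (n : ℝ) + 1) (b := (n : ℝ) + 1 + 1) (by positivity)
        (by positivity) hβ0.le hβ1
      rw [add_sub_cancel_left, mul_one] at h
      rw [div_le_iff₀ hβ0] at ih ⊢
      push_cast
      linarith
  constructor
  · refine le_trans ?_ hstrong
    gcongr
    linarith
  · clear hstrong
    induction n with
    | zero => simp [hβ0.ne']
    | succ n ih =>
      rw [Finset.sum_range_succ]
      have h := rpow_le_tangent (a := (n : ℝ) + 1) (b := n) (by positivity)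
        (by positivity) hβ0.le hβ1
      rw [le_div_iff₀ hβ0] at ih ⊢
      push_cast
      have : (n : ℝ) - (n + 1) = -1 := by ring
      rw [this] at h
      linarith

end PowerSums

/-! ### Location of the exponent -/

/-- The Malthusian exponent lies strictly between `0` and `1`. -/
theorem IsSplitting.exponent_mem_Ioo {Ω₀ : Type*} [MeasurableSpace Ω₀] {P₀ : Measure Ω₀}
    {X Y : ℕ → Ω₀ → ℝ} (hXY : IsSplitting P₀ X Y) {ν : Measure ℝ} {α ε : ℝ}
    (hM : Malthusian (intensity P₀ X) ν α ε) : 0 < α ∧ α < 1 := by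
  have hε := hM.eps_pos
  have hσ : ∀ᵐ x ∂familyIntensity P₀ X, x ∈ Set.Ioc (0 : ℝ) 1 :=
    ae_familyIntensity_mem_Ioc hXY.measurable_X fun i => hXY.mem_Icc_X.mono fun ω h => h i
  have hone : ∫⁻ x, ENNReal.ofReal x ^ α ∂familyIntensity P₀ X = 1 := by
    rw [← ofReal_integral_rpow (hσ.mono fun x hx => hx.1) (hM.psi_finite α (by linarith))]
    have := hM.integral_rpow_eq_one hσ
    change ∫ x, x ^ α ∂familyIntensity P₀ X = 1 at this
    rw [this, ENNReal.ofReal_one]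
  constructor
  -- For `α ≤ 0`, `x ^ α ≥ 1` on `(0, 1]`, so the mean number of crumbs would be at most `ψ(α) = 1`.
  · by_contra! hα
    have h1 : (familyIntensity P₀ X) Set.univ ≤ 1 := by
      rw [← hone, ← setLIntegral_one, Measure.restrict_univ]
      refine lintegral_mono_ae ?_
      filter_upwards [hσ] with x hx
      have h := ENNReal.rpow_le_rpow_of_exponent_ge (x := ENNReal.ofReal x)
        (by simpa using hx.2) hα
      rwa [ENNReal.rpow_zero] at h
    have h2 : (familyIntensity P₀ X) Set.univ =
        ∫⁻ ω, (({i | 0 < X i ω} : Set ℕ).encard : ℝ≥0∞) ∂P₀ := by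
      rw [familyIntensity, Measure.restrict_apply_univ, Measure.sum_apply _ measurableSet_Ioi]
      have h3 : ∀ ω, (({i | 0 < X i ω} : Set ℕ).encard : ℝ≥0∞) =
          ∑' i, (X i ⁻¹' Set.Ioi 0).indicator (1 : Ω₀ → ℝ≥0∞) ω := by
        intro ω
        rw [← ENNReal.tsum_set_one, tsum_subtype {i | 0 < X i ω} fun _ => (1 : ℝ≥0∞)]
        rfl
      simp_rw [h3]
      rw [lintegral_tsum fun i => (measurable_one.indicator
        (hXY.measurable_X i measurableSet_Ioi)).aemeasurable]
      refine tsum_congr fun i => ?_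
      rw [lintegral_indicator_one (hXY.measurable_X i measurableSet_Ioi),
        Measure.map_apply (hXY.measurable_X i) measurableSet_Ioi]
    have h3 := hXY.supercritical
    rw [← h2] at h3
    exact absurd h1 (not_le.mpr h3)
  -- For `α ≥ 1`, `x ^ α ≤ x` on `(0, 1]`, so the mean total size of crumbs would be at least `1`.
  · by_contra! hα
    have h1 : ∫⁻ x, ENNReal.ofReal x ∂familyIntensity P₀ X < 1 := by
      rw [lintegral_familyIntensity hXY.measurable_X (by fun_prop) fun x hx =>
        ENNReal.ofReal_of_nonpos hx, ← lintegral_tsum fun i =>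
          (hXY.measurable_X i).ennreal_ofReal.aemeasurable]
      exact hXY.mean_crumbs_lt_one
    have h2 : (1 : ℝ≥0∞) ≤ ∫⁻ x, ENNReal.ofReal x ∂familyIntensity P₀ X := by
      rw [← hone]
      refine lintegral_mono_ae ?_
      filter_upwards [hσ] with x hx
      have := ENNReal.rpow_le_rpow_of_exponent_ge (x := ENNReal.ofReal x) (by simpa using hx.2) hα
      simpa using this
    exact absurd h1 (not_lt.mpr h2)

/-! ### Integrability of binomial and Poisson weights -/

section Binomial

variable {lam : Measure ℝ}

theorem pow_le_rpow_of_mem_Ioc {x c : ℝ} (hx : x ∈ Set.Ioc (0 : ℝ) 1) (hc : c ≤ 1) {r : ℕ}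
    (hr : r ≠ 0) : x ^ r ≤ x ^ c := by
  rw [← Real.rpow_natCast]
  refine Real.rpow_le_rpow_of_exponent_ge hx.1 hx.2 (hc.trans ?_)
  exact_mod_cast Nat.one_le_iff_ne_zero.mpr hr

theorem integrable_pow_mul_one_sub_pow (hlam : ∀ᵐ x ∂lam, x ∈ Set.Ioc (0 : ℝ) 1) {c : ℝ}
    (hc : c ≤ 1) (hint : Integrable (fun x : ℝ => x ^ c) lam) {r : ℕ} (hr : r ≠ 0) (m : ℕ) :
    Integrable (fun x : ℝ => x ^ r * (1 - x) ^ m) lam := by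
  refine hint.mono' (by fun_prop) ?_
  filter_upwards [hlam] with x hx
  have h1 : 0 ≤ 1 - x := by linarith [hx.2]
  have h2 : (1 - x) ^ m ≤ 1 := pow_le_one₀ h1 (by linarith [hx.1])
  have h3 : 0 ≤ x ^ r := pow_nonneg hx.1.le r
  rw [Real.norm_of_nonneg (mul_nonneg h3 (pow_nonneg h1 m))]
  exact (mul_le_of_le_one_right h3 h2).trans (pow_le_rpow_of_mem_Ioc hx hc hr)

theorem integrable_pow_mul_exp (hlam : ∀ᵐ x ∂lam, x ∈ Set.Ioc (0 : ℝ) 1) {c : ℝ}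
    (hc : c ≤ 1) (hint : Integrable (fun x : ℝ => x ^ c) lam) {r : ℕ} (hr : r ≠ 0) {t : ℝ}
    (ht : 0 ≤ t) : Integrable (fun x : ℝ => (t * x) ^ r * Real.exp (-(t * x))) lam := by
  refine (hint.const_mul (t ^ r)).mono' (by fun_prop) ?_
  filter_upwards [hlam] with x hx
  have h2 : Real.exp (-(t * x)) ≤ 1 := Real.exp_le_one_iff.mpr (by nlinarith [hx.1])
  have h3 : 0 ≤ x ^ r := pow_nonneg hx.1.le r
  have h4 : 0 ≤ (t * x) ^ r := pow_nonneg (mul_nonneg ht hx.1.le) r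
  rw [Real.norm_of_nonneg (mul_nonneg h4 (Real.exp_pos _).le)]
  refine (mul_le_of_le_one_right h4 h2).trans ?_
  rw [mul_pow]
  have := pow_le_rpow_of_mem_Ioc hx hc hr
  gcongr

theorem toReal_lintegral_pow_mul_one_sub_pow (hlam : ∀ᵐ x ∂lam, x ∈ Set.Ioc (0 : ℝ) 1)
    (r m : ℕ) :
    (∫⁻ x, ENNReal.ofReal x ^ r * (1 - ENNReal.ofReal x) ^ m ∂lam).toReal =
      ∫ x, x ^ r * (1 - x) ^ m ∂lam := by
  rw [integral_eq_lintegral_of_nonneg_ae _ (by fun_prop)]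
  · congr 1
    refine lintegral_congr_ae ?_
    filter_upwards [hlam] with x hx
    rw [ENNReal.ofReal_mul (pow_nonneg hx.1.le r), ENNReal.ofReal_pow hx.1.le,
      ENNReal.ofReal_pow (by linarith [hx.2]), ENNReal.ofReal_sub _ hx.1.le, ENNReal.ofReal_one]
  · filter_upwards [hlam] with x hx
    exact mul_nonneg (pow_nonneg hx.1.le r) (pow_nonneg (by linarith [hx.2]) m)

end Binomial

/-! ### From the contour estimate to mean colour counts -/

section Asymptotics

variable {σ ν lam : Measure ℝ} [SFinite lam] {α ε c δ : ℝ}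

/-- Asymptotics of the mean number of colours represented exactly `r` times, in terms of the
intensity of the frequencies. -/
theorem Malthusian.norm_integral_binomial_sub_le (hM : Malthusian σ ν α ε)
    (hσ : ∀ᵐ x ∂σ, x ∈ Set.Ioc (0 : ℝ) 1) (hν : ∀ᵐ x ∂ν, x ∈ Set.Ioc (0 : ℝ) 1)
    (hlam : ∀ᵐ x ∂lam, x ∈ Set.Ioc (0 : ℝ) 1) (hαc : α < c) (hcα : c ≤ α + 1) (hc : c < 1)
    (hint : Integrable (fun x : ℝ => x ^ c) lam)
    (hmel : ∀ s : ℂ, s.re = c →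
      mellinTransform lam s = mellinTransform ν s / (1 - mellinTransform σ s))
    (hδ0 : 0 < δ) (hδ : δ < ε) (hδ1 : δ ≤ 1) {r : ℕ} (hr : r ≠ 0) :
    ∃ B : ℝ, ∀ n : ℕ, 1 ≤ n → r ≤ n →
      ‖((n.descFactorial r * ∫ x, x ^ r * (1 - x) ^ (n - r) ∂lam : ℝ) : ℂ) -
        (-mellinTransform ν α / deriv (mellinTransform σ) α) *
          (Real.Gamma (r - α) * (n : ℝ) ^ α : ℝ)‖ ≤ B * (n : ℝ) ^ (α - δ) := by
  set A := -mellinTransform ν α / deriv (mellinTransform σ) α with hA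
  set Φ : ℕ → ℝ → ℝ := fun k t => ∫ x, (t * x) ^ k * Real.exp (-(t * x)) ∂lam with hΦ
  have hren : ∀ k : ℕ, k ≠ 0 → ∃ B : ℝ, ∀ t : ℝ, 0 < t →
      ‖(Φ k t : ℂ) - A * (Real.Gamma (k - α) * t ^ α : ℝ)‖ ≤ B * t ^ (α - δ) := by
    intro k hk
    have hk1 : (1 : ℝ) ≤ k := by exact_mod_cast Nat.one_le_iff_ne_zero.mpr hk
    obtain ⟨B, hB⟩ := hM.norm_integral_pow_mul_exp_sub_le (r := k) hσ hν
      (hlam.mono fun x hx => hx.1) hαc hcα (by linarith) hint hmel hδ0 hδ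
    refine ⟨B, fun t ht => ?_⟩
    have := hB t ht
    rwa [integral_complex_ofReal] at this
  have hgrow : ∀ k : ℕ, k ≠ 0 → ∃ B : ℝ, ∀ t : ℝ, 1 ≤ t → Φ k t ≤ B * t ^ α := by
    intro k hk
    obtain ⟨B, hB⟩ := hren k hk
    refine ⟨|B| + ‖A‖ * |Real.Gamma (k - α)|, fun t ht => ?_⟩
    have ht0 : 0 < t := by linarith
    have htα : 0 < t ^ α := Real.rpow_pos_of_pos ht0 α
    have h1 : t ^ (α - δ) ≤ t ^ α := Real.rpow_le_rpow_of_exponent_le ht (by linarith)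
    have h2 := norm_le_norm_add_norm_sub' (Φ k t : ℂ) (A * (Real.Gamma (k - α) * t ^ α : ℝ))
    have h3 := hB t ht0
    rw [norm_mul, Complex.norm_real, Complex.norm_real, norm_mul, Real.norm_of_nonneg htα.le,
      Real.norm_eq_abs, Real.norm_eq_abs] at h2
    have h4 : B * t ^ (α - δ) ≤ |B| * t ^ α :=
      (mul_le_mul_of_nonneg_right (le_abs_self B) (Real.rpow_nonneg ht0.le _)).trans (by gcongr)
    have h5 := le_abs_self (Φ k t)
    linarith
  obtain ⟨B, hB⟩ := hren r hr
  obtain ⟨B₀, hB₀⟩ := hgrow r hr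
  obtain ⟨B₁, hB₁⟩ := hgrow (r + 1) (by omega)
  obtain ⟨B₂, hB₂⟩ := hgrow (r + 2) (by omega)
  set D := Real.exp r * (r ^ 2 + r + 1) with hD
  refine ⟨D * |B₀ + B₁ + B₂| + B, fun n hn hrn => ?_⟩
  have hn1 : (1 : ℝ) ≤ n := by exact_mod_cast hn
  have hn0 : (0 : ℝ) < n := by linarith
  have hI : ∀ k : ℕ, k ≠ 0 → Integrable (fun x : ℝ => (n * x) ^ k * Real.exp (-(n * x))) lam :=
    fun k hk => integrable_pow_mul_exp hlam hc.le hint hk hn0.le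
  have hpois : |n.descFactorial r * ∫ x, x ^ r * (1 - x) ^ (n - r) ∂lam - Φ r n| ≤
      D / n * (Φ r n + Φ (r + 1) n + Φ (r + 2) n) := by
    have hIb := (integrable_pow_mul_one_sub_pow hlam hc.le hint hr (n - r)).const_mul
      (n.descFactorial r : ℝ)
    have hI01 : Integrable (fun x : ℝ => (n * x) ^ r * Real.exp (-(n * x)) +
        (n * x) ^ (r + 1) * Real.exp (-(n * x))) lam := (hI r hr).add (hI (r + 1) (by omega))
    simp only [hΦ]
    rw [← integral_const_mul, ← integral_sub hIb (hI r hr),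
      ← integral_add (hI r hr) (hI (r + 1) (by omega)),
      ← integral_add hI01 (hI (r + 2) (by omega)),
      ← integral_const_mul, ← Real.norm_eq_abs]
    refine norm_integral_le_of_norm_le ((hI01.add (hI (r + 2) (by omega))).const_mul _) ?_
    filter_upwards [hlam] with x hx
    exact abs_descFactorial_mul_sub_le hn hrn hx.1.le hx.2
  have herr : D / n * (Φ r n + Φ (r + 1) n + Φ (r + 2) n) ≤
      D * |B₀ + B₁ + B₂| * (n : ℝ) ^ (α - δ) := by
    have h1 : Φ r n + Φ (r + 1) n + Φ (r + 2) n ≤ |B₀ + B₁ + B₂| * (n : ℝ) ^ α := by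
      have := mul_le_mul_of_nonneg_right (le_abs_self (B₀ + B₁ + B₂))
        (Real.rpow_nonneg hn0.le α)
      linarith [hB₀ n hn1, hB₁ n hn1, hB₂ n hn1]
    -- Poissonization costs `n ^ (α - 1)`, which is why `δ ≤ 1` is required.
    have h2 : (n : ℝ) ^ α / n ≤ (n : ℝ) ^ (α - δ) := by
      rw [← Real.rpow_sub_one hn0.ne']
      exact Real.rpow_le_rpow_of_exponent_le hn1 (by linarith)
    calc D / n * (Φ r n + Φ (r + 1) n + Φ (r + 2) n)
        ≤ D / n * (|B₀ + B₁ + B₂| * (n : ℝ) ^ α) := by gcongr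
      _ = D * |B₀ + B₁ + B₂| * ((n : ℝ) ^ α / n) := by ring
      _ ≤ _ := by gcongr
  refine (norm_sub_le_norm_sub_add_norm_sub _ (Φ r n : ℂ) _).trans ?_
  rw [← Complex.ofReal_sub, Complex.norm_real, Real.norm_eq_abs, add_mul]
  exact add_le_add (hpois.trans herr) (hB n hn0)

/-- Asymptotics of the mean number of colours, in terms of the intensity of the frequencies. -/
theorem Malthusian.norm_sum_integral_sub_le (hM : Malthusian σ ν α ε) (hα0 : 0 < α) (hα1 : α < 1)
    (hσ : ∀ᵐ x ∂σ, x ∈ Set.Ioc (0 : ℝ) 1) (hν : ∀ᵐ x ∂ν, x ∈ Set.Ioc (0 : ℝ) 1)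
    (hlam : ∀ᵐ x ∂lam, x ∈ Set.Ioc (0 : ℝ) 1) (hαc : α < c) (hcα : c ≤ α + 1) (hc : c < 1)
    (hint : Integrable (fun x : ℝ => x ^ c) lam)
    (hmel : ∀ s : ℂ, s.re = c →
      mellinTransform lam s = mellinTransform ν s / (1 - mellinTransform σ s))
    (hδ0 : 0 < δ) (hδ : δ < ε) (hδα : δ ≤ α) :
    ∃ B : ℝ, ∀ n : ℕ, 1 ≤ n →
      ‖((∑ m ∈ Finset.range n, ∫ x, x * (1 - x) ^ m ∂lam : ℝ) : ℂ) -
        (-mellinTransform ν α / deriv (mellinTransform σ) α) *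
          (Real.Gamma (1 - α) * ((n : ℝ) ^ α / α) : ℝ)‖ ≤ B * (n : ℝ) ^ (α - δ) := by
  set A := -mellinTransform ν α / deriv (mellinTransform σ) α with hA
  -- For `δ < α` the errors sum to order `n ^ (α - δ)` with `δ' = δ`. For `δ = α` this would give a
  -- logarithm; a slightly larger `δ'`, still below `ε` and `1`, makes the error series converge.
  obtain ⟨δ', hδ'0, hδ'ε, hδ'1, S, hS⟩ : ∃ δ' : ℝ, 0 < δ' ∧ δ' < ε ∧ δ' ≤ 1 ∧ ∃ S : ℝ,
      ∀ n : ℕ, 1 ≤ n → ∑ m ∈ Finset.range n, ((m : ℝ) + 1) ^ (α - δ' - 1) ≤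
        S * (n : ℝ) ^ (α - δ) := by
    rcases hδα.lt_or_eq with h | rfl
    · refine ⟨δ, hδ0, hδ, by linarith, 1 / (α - δ), fun n _ => ?_⟩
      have := (sum_rpow_bounds (β := α - δ) (by linarith) (by linarith) n).2
      rwa [div_eq_mul_one_div, mul_comm] at this
    · obtain ⟨δ', h1, h2⟩ := exists_between (lt_min hδ hα1)
      have h3 : Summable fun m : ℕ => ((m : ℝ) + 1) ^ (δ - δ' - 1) := by
        have := (summable_nat_add_iff 1).mpr
          (Real.summable_nat_rpow (p := δ - δ' - 1).mpr (by linarith))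
        simpa using this
      refine ⟨δ', by linarith, h2.trans_le (min_le_left _ _), (h2.trans_le (min_le_right _ _)).le,
        ∑' m : ℕ, ((m : ℝ) + 1) ^ (δ - δ' - 1), fun n _ => ?_⟩
      rw [sub_self, Real.rpow_zero, mul_one]
      exact h3.sum_le_tsum _ fun m _ => by positivity
  obtain ⟨B, hB⟩ := hM.norm_integral_binomial_sub_le hσ hν hlam hαc hcα hc hint hmel hδ'0 hδ'ε
    hδ'1 one_ne_zero
  set G := Real.Gamma (1 - α) with hG
  have hterm : ∀ m : ℕ, ‖((∫ x, x * (1 - x) ^ m ∂lam : ℝ) : ℂ) -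
      A * (G * ((m : ℝ) + 1) ^ (α - 1) : ℝ)‖ ≤ |B| * ((m : ℝ) + 1) ^ (α - δ' - 1) := by
    intro m
    have hm0 : (0 : ℝ) < (m : ℝ) + 1 := by positivity
    -- The case `r = 1` for `m + 1` balls; division by `m + 1` isolates the mean of one increment of
    -- the colour count.
    have h := hB (m + 1) (by omega) (by omega)
    simp only [Nat.descFactorial_one, pow_one, Nat.add_sub_cancel, Nat.cast_add, Nat.cast_one] at h
    have h1 : ((((m : ℝ) + 1) * ∫ x, x * (1 - x) ^ m ∂lam : ℝ) : ℂ) -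
        A * (G * ((m : ℝ) + 1) ^ α : ℝ) = (((m : ℝ) + 1 : ℝ) : ℂ) *
        (((∫ x, x * (1 - x) ^ m ∂lam : ℝ) : ℂ) - A * (G * ((m : ℝ) + 1) ^ (α - 1) : ℝ)) := by
      have h2 : ((m : ℝ) + 1) ^ α = ((m : ℝ) + 1) * ((m : ℝ) + 1) ^ (α - 1) := by
        rw [Real.rpow_sub_one hm0.ne']
        field_simp
      rw [h2, Complex.ofReal_mul, Complex.ofReal_mul, Complex.ofReal_mul, Complex.ofReal_mul]
      ring
    rw [h1, norm_mul, Complex.norm_real, Real.norm_of_nonneg hm0.le, mul_comm,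
      ← le_div_iff₀ hm0, mul_div_assoc, ← Real.rpow_sub_one hm0.ne'] at h
    refine h.trans ?_
    gcongr
    exact le_abs_self B
  refine ⟨|B| * S + ‖A‖ * (|G| * (1 / α)), fun n hn => ?_⟩
  have hn1 : (1 : ℝ) ≤ n := by exact_mod_cast hn
  have hsum : ‖((∑ m ∈ Finset.range n, ∫ x, x * (1 - x) ^ m ∂lam : ℝ) : ℂ) -
      A * (G * ∑ m ∈ Finset.range n, ((m : ℝ) + 1) ^ (α - 1) : ℝ)‖ ≤
      |B| * S * (n : ℝ) ^ (α - δ) := by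
    rw [Finset.mul_sum, Complex.ofReal_sum, Complex.ofReal_sum, Finset.mul_sum,
      ← Finset.sum_sub_distrib]
    refine (norm_sum_le_of_le _ fun m _ => hterm m).trans ?_
    rw [← Finset.mul_sum, mul_assoc]
    gcongr
    exact hS n hn
  have hpow : ‖A * (G * ∑ m ∈ Finset.range n, ((m : ℝ) + 1) ^ (α - 1) : ℝ) -
      A * (G * ((n : ℝ) ^ α / α) : ℝ)‖ ≤ ‖A‖ * (|G| * (1 / α)) * (n : ℝ) ^ (α - δ) := by
    rw [← mul_sub, ← Complex.ofReal_sub, ← mul_sub, norm_mul, Complex.norm_real, norm_mul,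
      Real.norm_eq_abs, Real.norm_eq_abs]
    obtain ⟨h1, h2⟩ := sum_rpow_bounds hα0 hα1.le n
    have h3 : |∑ m ∈ Finset.range n, ((m : ℝ) + 1) ^ (α - 1) - (n : ℝ) ^ α / α| ≤ 1 / α := by
      rw [sub_div] at h1
      have : 0 < 1 / α := by positivity
      rw [abs_le]
      constructor <;> linarith
    -- Replacing the power sum by `n ^ α / α` leaves a bounded error, absorbed because `δ ≤ α`.
    have h4 : 1 ≤ (n : ℝ) ^ (α - δ) := Real.one_le_rpow hn1 (by linarith)
    calc _ ≤ ‖A‖ * (|G| * (1 / α)) := by gcongr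
      _ ≤ _ := le_mul_of_one_le_right (by positivity) h4
  refine (norm_sub_le_norm_sub_add_norm_sub _
    (A * (G * ∑ m ∈ Finset.range n, ((m : ℝ) + 1) ^ (α - 1) : ℝ)) _).trans ?_
  rw [add_mul]
  exact add_le_add hsum hpow

end Asymptotics

end RecursivePartition

/-! ### The main theorem -/

theorem theorem1 {Ω₀ Ω : Type*} [MeasurableSpace Ω₀] [MeasurableSpace Ω]
    (P₀ : Measure Ω₀) [IsProbabilityMeasure P₀] (μ : Measure Ω) [IsProbabilityMeasure μ]
    (X Y : ℕ → Ω₀ → ℝ) (hXY : IsSplitting P₀ X Y)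
    (S : List ℕ → Ω → (ℕ → ℝ) × (ℕ → ℝ)) (hS : IsDivision P₀ X Y μ S)
    (C : ℕ → Ω → List ℕ × ℕ) (hC : IsPaintboxSample μ (solid S) C)
    (ψ φ : ℂ → ℂ) (hψ : ψ = mellinTransform (intensity P₀ X))
    (hφ : φ = mellinTransform (intensity P₀ Y))
    (α ε : ℝ) (hM : Malthusian (intensity P₀ X) (intensity P₀ Y) α ε) :
    (0 < α ∧ α < 1) ∧
    (DifferentiableAt ℂ ψ (α : ℂ) ∧ deriv ψ (α : ℂ) ≠ 0) ∧
    (∀ δ : ℝ, 0 < δ → δ < ε → δ ≤ α →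
      (fun n : ℕ => ((∫ ω, (numColors C n ω : ℝ) ∂μ : ℝ) : ℂ)
          - (((n : ℝ) ^ α : ℝ) : ℂ) * (Complex.Gamma (-(α : ℂ)) * φ α / deriv ψ α))
        =O[atTop] fun n : ℕ => (n : ℝ) ^ (α - δ)) ∧
    (∀ r : ℕ, 1 ≤ r → ∀ δ : ℝ, 0 < δ → δ < ε → δ ≤ 1 →
      (fun n : ℕ => ((∫ ω, (numColorsMult C n r ω : ℝ) ∂μ : ℝ) : ℂ)
          - (((n : ℝ) ^ α : ℝ) : ℂ) *
            (Complex.Gamma ((r : ℂ) - α) * φ α / (-(r.factorial : ℂ) * deriv ψ α)))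
        =O[atTop] fun n : ℕ => (n : ℝ) ^ (α - δ)) := by
  subst hψ hφ
  have hε := hM.eps_pos
  have hσ : ∀ᵐ x ∂intensity P₀ X, x ∈ Set.Ioc (0 : ℝ) 1 :=
    ae_familyIntensity_mem_Ioc hXY.measurable_X fun i => hXY.mem_Icc_X.mono fun ω h => h i
  have hν : ∀ᵐ x ∂intensity P₀ Y, x ∈ Set.Ioc (0 : ℝ) 1 :=
    ae_familyIntensity_mem_Ioc hXY.measurable_Y fun i => hXY.mem_Icc_Y.mono fun ω h => h i
  have hP := hS.ae_solid_mem_Icc hXY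
  have hlam : ∀ᵐ x ∂familyIntensity μ (solid S), x ∈ Set.Ioc (0 : ℝ) 1 :=
    ae_familyIntensity_mem_Ioc hS.measurable_solid hP
  obtain ⟨hα0, hα1⟩ := hXY.exponent_mem_Ioo hM
  have hψ' := hM.deriv_psi_ne_zero hσ
  -- The line of inversion: `c > α` makes the geometric series over words converge, and `c < 1 ≤ r`
  -- keeps the argument of `Γ(r - s)` in the right half-plane.
  obtain ⟨c, hαc, hc1⟩ := exists_between hα1
  have hX := hM.psi_finite c (by linarith)
  have hX1 := hM.integral_rpow_lt_one hσ hαc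
  have hY := hM.phi_integrable hν (a := c) (by linarith)
  have hint := hS.integrable_rpow_solid hXY (hα0.trans hαc) hX hX1 hY
  have hmel : ∀ s : ℂ, s.re = c → mellinTransform (familyIntensity μ (solid S)) s =
      mellinTransform (intensity P₀ Y) s / (1 - mellinTransform (intensity P₀ X) s) := by
    intro s hs
    subst hs
    exact hS.mellinTransform_solid hXY (hα0.trans hαc) hX hX1 hY
  refine ⟨⟨hα0, hα1⟩, ⟨hM.differentiableAt_psi hσ (by simp [hε]), hψ'⟩, ?_, ?_⟩
  · intro δ hδ0 hδ hδα
    obtain ⟨B, hB⟩ := hM.norm_sum_integral_sub_le hα0 hα1 hσ hν hlam hαc (by linarith) hc1 hint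
      hmel hδ0 hδ hδα
    refine IsBigO.of_bound B ?_
    filter_upwards [eventually_ge_atTop 1] with n hn
    have hE : ∫ ω, (numColors C n ω : ℝ) ∂μ =
        ∑ m ∈ Finset.range n, ∫ x, x * (1 - x) ^ m ∂familyIntensity μ (solid S) := by
      obtain ⟨h1, h2⟩ := hC.measurable_numColors_and_lintegral hP n
      have h3 := integral_toReal h1.aemeasurable (ae_of_all μ fun ω => ENNReal.natCast_lt_top _)
      simp only [ENNReal.toReal_natCast] at h3
      rw [h3, h2, ENNReal.toReal_sum]
      · refine Finset.sum_congr rfl fun m _ => ?_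
        simpa using toReal_lintegral_pow_mul_one_sub_pow hlam 1 m
      · intro m _
        refine ne_top_of_le_ne_top
          ((integrable_rpow_iff_lintegral_ne_top (hlam.mono fun x hx => hx.1)).mp hint) ?_
        refine lintegral_mono_ae ?_
        filter_upwards [hlam] with x hx
        refine (mul_le_of_le_one_right' (pow_le_one' tsub_le_self m)).trans ?_
        have := ENNReal.rpow_le_rpow_of_exponent_ge (x := ENNReal.ofReal x) (by simpa using hx.2)
          hc1.le
        simpa using this
    -- This turns `Γ(1 - α) / α` into `-Γ(-α)`, whose sign cancels that of the residue.
    have hΓ : (Real.Gamma (1 - α) : ℂ) = -α * Complex.Gamma (-α) := by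
      rw [← Complex.Gamma_add_one _ (by simpa using hα0.ne'), ← Complex.Gamma_ofReal]
      push_cast
      ring_nf
    have hα0' : (α : ℂ) ≠ 0 := by exact_mod_cast hα0.ne'
    rw [Real.norm_of_nonneg (Real.rpow_nonneg n.cast_nonneg _)]
    refine le_of_eq_of_le ?_ (hB n hn)
    rw [hE, Complex.ofReal_mul, hΓ, Complex.ofReal_div]
    congr 2
    field_simp
  · intro r hr δ hδ0 hδ hδ1
    have hr0 : r ≠ 0 := by omega
    obtain ⟨B, hB⟩ := hM.norm_integral_binomial_sub_le hσ hν hlam hαc (by linarith) hc1 hint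
      hmel hδ0 hδ hδ1 hr0
    have hf0 : (0 : ℝ) < r.factorial := by exact_mod_cast r.factorial_pos
    refine IsBigO.of_bound (B / r.factorial) ?_
    filter_upwards [eventually_ge_atTop 1, eventually_ge_atTop r] with n hn hrn
    have hE : ∫ ω, (numColorsMult C n r ω : ℝ) ∂μ = n.choose r *
        ∫ x, x ^ r * (1 - x) ^ (n - r) ∂familyIntensity μ (solid S) := by
      have h3 := integral_toReal (hC.measurable_numColorsMult n r hr0).aemeasurable
        (ae_of_all μ fun ω => ENNReal.natCast_lt_top _)
      simp only [ENNReal.toReal_natCast] at h3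
      rw [h3, hC.lintegral_numColorsMult hP n r hr0, ENNReal.toReal_mul, ENNReal.toReal_natCast,
        toReal_lintegral_pow_mul_one_sub_pow hlam]
    have hΓ : (Real.Gamma (r - α) : ℂ) = Complex.Gamma (r - α) := by
      rw [← Complex.Gamma_ofReal]
      push_cast
      rfl
    have hf0' : (r.factorial : ℂ) ≠ 0 := by exact_mod_cast r.factorial_ne_zero
    have h := hB n hn hrn
    rw [Real.norm_of_nonneg (Real.rpow_nonneg n.cast_nonneg _), div_mul_eq_mul_div,
      le_div_iff₀ hf0, mul_comm, ← Real.norm_of_nonneg hf0.le, ← Complex.norm_real, ← norm_mul]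
    refine le_of_eq_of_le ?_ h
    rw [hE, Nat.descFactorial_eq_factorial_mul_choose, Complex.ofReal_mul (Real.Gamma _), hΓ]
    congr 1
    push_cast
    field_simp
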